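/- Consider the call-by-value $\lambda$-calculus with shift and reset. Terms and values, taken up to $\alpha$-conversion, are $t ::= x \mid \lambda x.t \mid t\,t \mid \mathcal{S}k.t \mid \langle t\rangle$ and $v ::= \lambda x.t \mid x$, over a countably infinite set of variables, where $\lambda x.t$ binds $x$ and $\mathcal{S}k.t$ binds $k$ in $t$. Pure contexts, evaluation contexts and general contexts are $E ::= \square \mid v\,E \mid E\,t$, $\;F ::= \square \mid v\,F \mid F\,t \mid \langle F\rangle$, $\;C ::= \square \mid \lambda x.C \mid t\,C \mid C\,t \mid \mathcal{S}k.C \mid \langle C\rangle$; filling a context may capture free variables. Reduction $\to$ is given by $F[(\lambda x.t)\,v] \to F[t\{v/x\}]$, $\;F[\langle E[\mathcal{S}k.t]\rangle] \to F[\langle t\{\lambda x.\langle E[x]\rangle/k\}\rangle]$ with $x\notin \mathrm{fv}(E)$, and $F[\langle v\rangle]\to F[v]$. Write $t\Downarrow t'$ if $t\to^* t'$ and $t'$ is irreducible. A term is control stuck if it is of the form $E[\mathcal{S}k.t]$. Contextual equivalence: $t_0\cong t_1$ if for all $C$ such that $C[t_0]$ and $C[t_1]$ are closed, $C[t_0]$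 evaluates to a value iff $C[t_1]$ does, and $C[t_0]$ evaluates to a control stuck term iff $C[t_1]$ does. A variable is fresh if it does not occur free in the terms or contexts under consideration. Put $x\bullet y = x\,y$ and $(\lambda x.t)\bullet y = t\{y/x\}$. For a relation $R$ on terms: * $v_0\,R^{r}\,v_1$ if $(v_0\bullet x)\,R\,(v_1\bullet x)$ for a fresh $x$; * $F_0\,R\,F_1$ if either $F_0=E_0$ and $F_1=E_1$ are pure with $E_0[x]\,R\,E_1[x]$ for a fresh $x$, or $F_0=F_0'[\langle E_0\rangle]$, $F_1=F_1'[\langle E_1\rangle]$ with $F_0'[x]\,R\,F_1'[x]$ and $\langle E_0[x]\rangle\,R\,\langle E_1[x]\rangle$ for a fresh $x$; * $F_0[x\,v_0]\,R^{r}\,F_1[x\,v_1]$ if $F_0\,R\,F_1$ and $v_0\,R^{r}\,v_1$; * $E_0[\mathcal{S}k.t_0]\,R^{r}\,E_1[\mathcal{S}k.t_1]$ if $\langle t_0\{\lambda x.\langle k'\,E_0[x]\rangle/k\}\rangle\,R\,\langle t_1\{\lambda x.\langle k'\,E_1[x]\rangle/k\}\rangle$ for fresh $k',x$. $R$ is a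 refined normal form simulation if $t_0\,R\,t_1$ and $t_0\Downarrow t_0'$ imply $t_1\Downarrow t_1'$ and $t_0'\,R^{r}\,t_1'$ for some $t_1'$; it is a refined bisimulation if both $R$ and $R^{-1}$ are refined simulations. Refined bisimilarity $\approx_r$ is the largest refined bisimulation. The substitutive, bisimilar and context closure $\widehat{R}$ of $R$ is the least relation such that: $t\,\widehat R\,t$; $R\subseteq\widehat R$; if $t_0\,\widehat R\,t_1$ and $v_0\,\widehat R^{\,r}\,v_1$ then $t_0\{v_0/x\}\,\widehat R\,t_1\{v_1/x\}$; if $t_0\,\widehat R\,t_1$ and $F_0\,\widehat R\,F_1$ then $F_0[t_0]\,\widehat R\,F_1[t_1]$; if $t_0\,\widehat R\,t_1$ then $\lambda x.t_0\,\widehat R\,\lambda x.t_1$ and $\mathcal{S}k.t_0\,\widehat R\,\mathcal{S}k.t_1$; and if $t_0\approx_r t_0'$, $t_0'\,\widehat R\,t_1'$ and $t_1'\approx_r t_1$ then $t_0\,\widehat R\,t_1$. **Theorem.** 1. If $R$ is a refined bisimulation, then so is $\widehat R$. 2. The relation $\approx_r$ is a congruence, i.e. an equivalence relation such that $t_0\approx_r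 t_1$ implies $C[t_0]\approx_r C[t_1]$ for every context $C$. 3. $\approx_r\,\subsetneq\,\cong$: refined bisimilarity is sound with respect to contextual equivalence, and the inclusion is strict. -/

import Mathlib

namespace ShiftReset

/-! ### Syntax

Terms up to `α`-conversion are represented with de Bruijn indices.  The term variables are the
natural numbers; at top level, `var n` is the free variable `n`.  The binders
`λ x. t` and `S k. t` that bind a *named* variable are `Tm.abs x t` and `Tm.absShift k t` below. -/

/-- Terms `t ::= x | λx.t | t t | S k.t | ⟨t⟩`. -/
inductive Tm : Type
  | var (n : ℕ)
  | lam (t : Tm)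
  | app (t s : Tm)
  | shift (t : Tm)
  | reset (t : Tm)

/-- Values `v ::= λx.t | x`. -/
inductive Val : Type
  | var (n : ℕ)
  | lam (t : Tm)

/-- Values are terms. -/
def Val.toTm : Val → Tm
  | .var n => .var n
  | .lam t => .lam t

/-- Lifting of a renaming under a binder. -/
def upRen (ρ : ℕ → ℕ) : ℕ → ℕ
  | 0 => 0
  | n + 1 => ρ n + 1

/-- Renaming of the free variables of a term. -/
def Tm.rename : (ℕ → ℕ) → Tm → Tm
  | ρ, .var n => .var (ρ n)
  | ρ, .lam t => .lam (t.rename (upRen ρ))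
  | ρ, .app t s => .app (t.rename ρ) (s.rename ρ)
  | ρ, .shift t => .shift (t.rename (upRen ρ))
  | ρ, .reset t => .reset (t.rename ρ)

/-- Renaming of the free variables of a value. -/
def Val.rename (ρ : ℕ → ℕ) : Val → Val
  | .var n => .var (ρ n)
  | .lam t => .lam (t.rename (upRen ρ))

/-- Lifting of a substitution under a binder. -/
def upSub (σ : ℕ → Val) : ℕ → Val
  | 0 => .var 0
  | n + 1 => (σ n).rename Nat.succ

/-- Simultaneous capture-avoiding substitution of values for the free variables of a term. -/
def Tm.subst : (ℕ → Val) → Tm → Tm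
  | σ, .var n => (σ n).toTm
  | σ, .lam t => .lam (t.subst (upSub σ))
  | σ, .app t s => .app (t.subst σ) (s.subst σ)
  | σ, .shift t => .shift (t.subst (upSub σ))
  | σ, .reset t => .reset (t.subst σ)

/-- If `t` is the body of a binder, `t.inst v` is the substitution of `v` for the variable bound
by it. -/
def Tm.inst (t : Tm) (v : Val) : Tm :=
  t.subst fun n => match n with
    | 0 => v
    | n + 1 => .var n

/-- `t{v/x}`, for a free variable `x`. -/
def Tm.substVar (t : Tm) (x : ℕ) (v : Val) : Tm :=
  t.subst fun n => if n = x then v else .var n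

/-- `x` is a free variable of the term. -/
def Tm.Free : ℕ → Tm → Prop
  | x, .var n => x = n
  | x, .lam t => t.Free (x + 1)
  | x, .app t s => t.Free x ∨ s.Free x
  | x, .shift t => t.Free (x + 1)
  | x, .reset t => t.Free x

/-- A term is closed if it has no free variables. -/
def Tm.Closed (t : Tm) : Prop := ∀ x, ¬ t.Free x

/-- Turn the free variable `x` of a term into the variable bound by an enclosing binder. -/
def bindRen (x n : ℕ) : ℕ := if n = x then 0 else n + 1

/-- `λ x. t`, where `x` is a named variable which may occur free in `t`. -/
def Tm.abs (x : ℕ) (t : Tm) : Tm := .lam (t.rename (bindRen x))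

/-- `S k. t`, where `k` is a named variable which may occur free in `t`. -/
def Tm.absShift (k : ℕ) (t : Tm) : Tm := .shift (t.rename (bindRen k))

/-! ### Contexts -/

/-- Pure contexts `E ::= □ | v E | E t`. -/
inductive PureCtx : Type
  | hole
  | appR (v : Val) (E : PureCtx)
  | appL (E : PureCtx) (t : Tm)

/-- Evaluation contexts `F ::= □ | v F | F t | ⟨F⟩`. -/
inductive EvalCtx : Type
  | hole
  | appR (v : Val) (F : EvalCtx)
  | appL (F : EvalCtx) (t : Tm)
  | reset (F : EvalCtx)

/-- Contexts `C ::= □ | λ x. C | t C | C t | S k. C | ⟨C⟩`. -/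
inductive Ctx : Type
  | hole
  | lam (x : ℕ) (C : Ctx)
  | appR (t : Tm) (C : Ctx)
  | appL (C : Ctx) (t : Tm)
  | shift (k : ℕ) (C : Ctx)
  | reset (C : Ctx)

def PureCtx.plug : PureCtx → Tm → Tm
  | .hole, t => t
  | .appR v E, t => .app v.toTm (E.plug t)
  | .appL E s, t => .app (E.plug t) s

def EvalCtx.plug : EvalCtx → Tm → Tm
  | .hole, t => t
  | .appR v F, t => .app v.toTm (F.plug t)
  | .appL F s, t => .app (F.plug t) s
  | .reset F, t => .reset (F.plug t)

/-- Filling a context; the binders of the context capture free variables of the term. -/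
def Ctx.plug : Ctx → Tm → Tm
  | .hole, t => t
  | .lam x C, t => .abs x (C.plug t)
  | .appR s C, t => .app s (C.plug t)
  | .appL C s, t => .app (C.plug t) s
  | .shift k C, t => .absShift k (C.plug t)
  | .reset C, t => .reset (C.plug t)

def PureCtx.rename (ρ : ℕ → ℕ) : PureCtx → PureCtx
  | .hole => .hole
  | .appR v E => .appR (v.rename ρ) (E.rename ρ)
  | .appL E t => .appL (E.rename ρ) (t.rename ρ)

/-- `x` is a free variable of the pure context. -/
def PureCtx.Free (x : ℕ) : PureCtx → Prop
  | .hole => False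
  | .appR v E => v.toTm.Free x ∨ E.Free x
  | .appL E t => E.Free x ∨ t.Free x

/-- `x` is a free variable of the evaluation context. -/
def EvalCtx.Free (x : ℕ) : EvalCtx → Prop
  | .hole => False
  | .appR v F => v.toTm.Free x ∨ F.Free x
  | .appL F t => F.Free x ∨ t.Free x
  | .reset F => F.Free x

/-- A pure context is an evaluation context. -/
def PureCtx.toEval : PureCtx → EvalCtx
  | .hole => .hole
  | .appR v E => .appR v E.toEval
  | .appL E t => .appL E.toEval t

/-- Composition of evaluation contexts: `F.comp G` is `F[G]`. -/
def EvalCtx.comp : EvalCtx → EvalCtx → EvalCtx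
  | .hole, G => G
  | .appR v F, G => .appR v (F.comp G)
  | .appL F t, G => .appL (F.comp G) t
  | .reset F, G => .reset (F.comp G)

/-! ### Reduction semantics -/

/-- The value `λ x. ⟨E[x]⟩` with `x` not free in `E`. -/
def PureCtx.reify (E : PureCtx) : Val :=
  .lam (.reset ((E.rename Nat.succ).plug (.var 0)))

/-- The value `λ x. ⟨k' E[x]⟩` with `x` distinct from `k'` and not free in `E`. -/
def PureCtx.reifyWith (k' : ℕ) (E : PureCtx) : Val :=
  (PureCtx.appR (.var k') E).reify

/-- One-step call-by-value reduction. -/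
inductive Red : Tm → Tm → Prop
  | beta (F : EvalCtx) (t : Tm) (v : Val) :
      Red (F.plug (.app (.lam t) v.toTm)) (F.plug (t.inst v))
  | shift (F : EvalCtx) (E : PureCtx) (t : Tm) :
      Red (F.plug (.reset (E.plug (.shift t)))) (F.plug (.reset (t.inst E.reify)))
  | reset (F : EvalCtx) (v : Val) :
      Red (F.plug (.reset v.toTm)) (F.plug v.toTm)

/-- Evaluation: `t` reduces in finitely many steps to the irreducible term `t'`. -/
def Eval (t t' : Tm) : Prop :=
  Relation.ReflTransGen Red t t' ∧ ∀ t'', ¬ Red t' t''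

def Tm.IsValue (t : Tm) : Prop := ∃ v : Val, t = v.toTm

def Tm.ControlStuck (t : Tm) : Prop := ∃ (E : PureCtx) (s : Tm), t = E.plug (.shift s)

/-! ### Contextual equivalence -/

/-- One half of the observations of contextual equivalence. -/
def ObsLe (p q : Tm) : Prop :=
  ((∃ p', Eval p p' ∧ p'.IsValue) → ∃ q', Eval q q' ∧ q'.IsValue) ∧
  ((∃ p', Eval p p' ∧ p'.ControlStuck) → ∃ q', Eval q q' ∧ q'.ControlStuck)

/-- Contextual equivalence. -/
def CtxEquiv (t₀ t₁ : Tm) : Prop :=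
  ∀ C : Ctx, (C.plug t₀).Closed → (C.plug t₁).Closed →
    ObsLe (C.plug t₀) (C.plug t₁) ∧ ObsLe (C.plug t₁) (C.plug t₀)

/-! ### Refined normal form bisimilarity -/

/-- The application `v • y` of a value to a variable, which is `x y` if `v = x` and `t{y/x}` if
`v = λ x. t`. -/
def Val.appVar : Val → ℕ → Tm
  | .var n, y => .app (.var n) (.var y)
  | .lam t, y => t.inst (.var y)

/-- Extension of a relation on terms to evaluation contexts. -/
inductive CtxRel (R : Tm → Tm → Prop) : EvalCtx → EvalCtx → Prop
  | pure (E₀ E₁ : PureCtx) (x : ℕ) :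
      ¬ E₀.Free x → ¬ E₁.Free x →
      R (E₀.plug (.var x)) (E₁.plug (.var x)) →
      CtxRel R E₀.toEval E₁.toEval
  | delimited (F₀ F₁ : EvalCtx) (E₀ E₁ : PureCtx) (x : ℕ) :
      ¬ F₀.Free x → ¬ F₁.Free x → ¬ E₀.Free x → ¬ E₁.Free x →
      R (F₀.plug (.var x)) (F₁.plug (.var x)) →
      R (.reset (E₀.plug (.var x))) (.reset (E₁.plug (.var x))) →
      CtxRel R (F₀.comp (.reset E₀.toEval)) (F₁.comp (.reset E₁.toEval))

/-- Extension of a relation on terms to values, by application to a fresh variable. -/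
def ValRel (R : Tm → Tm → Prop) (v₀ v₁ : Val) : Prop :=
  ∃ x : ℕ, ¬ v₀.toTm.Free x ∧ ¬ v₁.toTm.Free x ∧ R (v₀.appVar x) (v₁.appVar x)

/-- The refined extension of a relation on terms to normal forms. -/
inductive RefinedNF (R : Tm → Tm → Prop) : Tm → Tm → Prop
  | value (v₀ v₁ : Val) : ValRel R v₀ v₁ → RefinedNF R v₀.toTm v₁.toTm
  | control (E₀ E₁ : PureCtx) (t₀ t₁ : Tm) (k' : ℕ) :
      ¬ (E₀.plug (.shift t₀)).Free k' → ¬ (E₁.plug (.shift t₁)).Free k' →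
      R (.reset (t₀.inst (E₀.reifyWith k'))) (.reset (t₁.inst (E₁.reifyWith k'))) →
      RefinedNF R (E₀.plug (.shift t₀)) (E₁.plug (.shift t₁))
  | openStuck (x : ℕ) (F₀ F₁ : EvalCtx) (v₀ v₁ : Val) :
      CtxRel R F₀ F₁ → ValRel R v₀ v₁ →
      RefinedNF R (F₀.plug (.app (.var x) v₀.toTm)) (F₁.plug (.app (.var x) v₁.toTm))

/-- Refined normal form simulations. -/
def IsRefinedSimulation (R : Tm → Tm → Prop) : Prop :=
  ∀ t₀ t₁ t₀', R t₀ t₁ → Eval t₀ t₀' → ∃ t₁', Eval t₁ t₁' ∧ RefinedNF R t₀' t₁'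

/-- Refined normal form bisimulations. -/
def IsRefinedBisimulation (R : Tm → Tm → Prop) : Prop :=
  IsRefinedSimulation R ∧ IsRefinedSimulation fun t₁ t₀ => R t₀ t₁

/-- Refined normal form bisimilarity: the union of all refined bisimulations.  It is the largest
one by `refinedBisimilar_isGreatest`. -/
def RefinedBisimilar (t₀ t₁ : Tm) : Prop :=
  ∃ R : Tm → Tm → Prop, IsRefinedBisimulation R ∧ R t₀ t₁

theorem RefinedNF.mono {R S : Tm → Tm → Prop} (h : ∀ a b, R a b → S a b) {t s : Tm}
    (hts : RefinedNF R t s) : RefinedNF S t s := by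
  cases hts with
  | value v₀ v₁ hv =>
    obtain ⟨x, h0, h1, hr⟩ := hv
    exact .value _ _ ⟨x, h0, h1, h _ _ hr⟩
  | control E₀ E₁ t₀ t₁ k' h0 h1 hr => exact .control _ _ _ _ k' h0 h1 (h _ _ hr)
  | openStuck x F₀ F₁ v₀ v₁ hF hv =>
    obtain ⟨y, h0, h1, hr⟩ := hv
    refine .openStuck _ _ _ _ _ ?_ ⟨y, h0, h1, h _ _ hr⟩
    cases hF with
    | pure E₀ E₁ x a b c => exact .pure _ _ x a b (h _ _ c)
    | delimited F₀ F₁ E₀ E₁ x a b c d e f =>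
      exact .delimited _ _ _ _ x a b c d (h _ _ e) (h _ _ f)

theorem refinedBisimilar_isGreatest :
    IsGreatest {R : Tm → Tm → Prop | IsRefinedBisimulation R} RefinedBisimilar := by
  refine ⟨⟨?_, ?_⟩, fun R hR t s h => ⟨R, hR, h⟩⟩
  · rintro t₀ t₁ t₀' ⟨R, hR, h⟩ he
    obtain ⟨t₁', h1, h2⟩ := hR.1 _ _ _ h he
    exact ⟨t₁', h1, h2.mono fun a b hab => ⟨R, hR, hab⟩⟩
  · rintro t₁ t₀ t₁' ⟨R, hR, h⟩ he
    obtain ⟨t₀', h1, h2⟩ := hR.2 _ _ _ h he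
    exact ⟨t₀', h1, h2.mono fun a b hab => ⟨R, hR, hab⟩⟩

/-- The substitutive, bisimilar, and context closure of a relation.  The premises of `subst` are
those of `ValRel`, and `pureCtx` and `delimitedCtx` spell out the two cases of `CtxRel`, for the
closure itself. -/
inductive Closure (R : Tm → Tm → Prop) : Tm → Tm → Prop
  | refl (t : Tm) : Closure R t t
  | base (t₀ t₁ : Tm) : R t₀ t₁ → Closure R t₀ t₁
  | subst (t₀ t₁ : Tm) (x : ℕ) (v₀ v₁ : Val) (y : ℕ) :
      Closure R t₀ t₁ →
      ¬ v₀.toTm.Free y → ¬ v₁.toTm.Free y → Closure R (v₀.appVar y) (v₁.appVar y) →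
      Closure R (t₀.substVar x v₀) (t₁.substVar x v₁)
  | pureCtx (t₀ t₁ : Tm) (E₀ E₁ : PureCtx) (x : ℕ) :
      Closure R t₀ t₁ →
      ¬ E₀.Free x → ¬ E₁.Free x →
      Closure R (E₀.plug (.var x)) (E₁.plug (.var x)) →
      Closure R (E₀.plug t₀) (E₁.plug t₁)
  | delimitedCtx (t₀ t₁ : Tm) (F₀ F₁ : EvalCtx) (E₀ E₁ : PureCtx) (x : ℕ) :
      Closure R t₀ t₁ →
      ¬ F₀.Free x → ¬ F₁.Free x → ¬ E₀.Free x → ¬ E₁.Free x →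
      Closure R (F₀.plug (.var x)) (F₁.plug (.var x)) →
      Closure R (.reset (E₀.plug (.var x))) (.reset (E₁.plug (.var x))) →
      Closure R (F₀.plug (.reset (E₀.plug t₀))) (F₁.plug (.reset (E₁.plug t₁)))
  | lam (x : ℕ) (t₀ t₁ : Tm) : Closure R t₀ t₁ → Closure R (.abs x t₀) (.abs x t₁)
  | shift (k : ℕ) (t₀ t₁ : Tm) :
      Closure R t₀ t₁ → Closure R (.absShift k t₀) (.absShift k t₁)
  | bisim (t₀ t₀' t₁' t₁ : Tm) :
      RefinedBisimilar t₀ t₀' → Closure R t₀' t₁' → RefinedBisimilar t₁' t₁ →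
      Closure R t₀ t₁

/-- A congruence is an equivalence relation preserved by all contexts. -/
def IsCongruence (R : Tm → Tm → Prop) : Prop :=
  Equivalence R ∧ ∀ (C : Ctx) (t₀ t₁ : Tm), R t₀ t₁ → R (C.plug t₀) (C.plug t₁)

end ShiftReset

/-!
A captured context is applied through `λx.⟨E[x]⟩`, so running a term `t` in the context `⟨E⟩` and
applying the reified context to `t` differ by one administrative β-step. The relation `Adm` allows
arbitrarily many such differences and is a simulation in both directions that preserves the number
of captures.

Congruence follows by running closures of bisimilar terms in related stacks of frames. Each
evaluation either is the image of an evaluation of the bisimilar terms, or pops a frame, or captures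
a context made of related frames, which agree with their composition up to administrative
reductions. Since the latter may change the number of steps, the induction is on the lexicographic
triple of the number of captures, the number of steps, and the number of frames.

The inclusion in contextual equivalence is strict because of `⟨t⟩ Ω` and `Ω`: in a closed program
`⟨t⟩` can be neither control stuck nor open stuck, so that both terms diverge, whereas a variable
called inside `t` makes the former an open stuck normal form.
-/

namespace ShiftReset

attribute [simp] Tm.rename Tm.subst PureCtx.plug EvalCtx.plug PureCtx.rename
  PureCtx.toEval EvalCtx.comp

/-! ### Calculus of substitutions -/

/-- Simultaneous substitution in a value. -/
def Val.subst (σ : ℕ → Val) : Val → Val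
  | .var n => σ n
  | .lam t => .lam (t.subst (upSub σ))

/-- The substitution `v · σ`, which maps the variable `0` to `v` and `n + 1` to `σ n`. -/
def scons (v : Val) (σ : ℕ → Val) : ℕ → Val
  | 0 => v
  | n + 1 => σ n

section Substitution

variable (t : Tm) (v : Val) (ρ ξ : ℕ → ℕ) (σ τ : ℕ → Val)

@[simp] theorem Val.toTm_var (n : ℕ) : (Val.var n).toTm = .var n := rfl

@[simp] theorem Val.toTm_lam : (Val.lam t).toTm = .lam t := rfl

@[simp] theorem upSub_succ (n : ℕ) : upSub σ (n + 1) = (σ n).rename Nat.succ := rfl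

@[simp] theorem scons_succ (n : ℕ) : scons v σ (n + 1) = σ n := rfl

theorem Tm.inst_eq_subst : t.inst v = t.subst (scons v .var) := by
  unfold Tm.inst; congr 1

@[simp] theorem Val.toTm_inj {v w : Val} : v.toTm = w.toTm ↔ v = w := by
  cases v <;> cases w <;> simp

theorem Val.toTm_rename : (v.rename ρ).toTm = v.toTm.rename ρ := by
  cases v <;> rfl

theorem Val.toTm_subst : (v.subst σ).toTm = v.toTm.subst σ := by
  cases v <;> rfl

theorem upRen_comp_upRen : upRen ξ ∘ upRen ρ = upRen (ξ ∘ ρ) := by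
  funext n; cases n <;> rfl

theorem Tm.rename_rename : (t.rename ρ).rename ξ = t.rename (ξ ∘ ρ) := by
  induction t generalizing ρ ξ <;> simp [*, upRen_comp_upRen]

theorem Val.rename_rename : (v.rename ρ).rename ξ = v.rename (ξ ∘ ρ) := by
  simp only [← Val.toTm_inj, Val.toTm_rename, Tm.rename_rename]

theorem upSub_var_comp : upSub (Val.var ∘ ρ) = Val.var ∘ upRen ρ := by
  funext n; cases n <;> rfl

theorem Tm.rename_eq_subst : t.rename ρ = t.subst (Val.var ∘ ρ) := by
  induction t generalizing ρ <;> simp [*, upSub_var_comp]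

theorem Val.rename_eq_subst : v.rename ρ = v.subst (Val.var ∘ ρ) := by
  simp only [← Val.toTm_inj, Val.toTm_rename, Val.toTm_subst, Tm.rename_eq_subst]

theorem upSub_comp_upRen : upSub σ ∘ upRen ρ = upSub (σ ∘ ρ) := by
  funext n; cases n <;> rfl

theorem Tm.subst_rename : (t.rename ρ).subst σ = t.subst (σ ∘ ρ) := by
  induction t generalizing ρ σ <;> simp [*, upSub_comp_upRen]

theorem Val.subst_rename : (v.rename ρ).subst σ = v.subst (σ ∘ ρ) := by
  simp only [← Val.toTm_inj, Val.toTm_rename, Val.toTm_subst, Tm.subst_rename]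

theorem rename_upRen_upSub :
    (fun n => (upSub σ n).rename (upRen ρ)) = upSub fun n => (σ n).rename ρ := by
  funext n
  cases n with
  | zero => rfl
  | succ n => simp only [upSub_succ, Val.rename_rename]; rfl

theorem Tm.rename_subst : (t.subst σ).rename ρ = t.subst fun n => (σ n).rename ρ := by
  induction t generalizing ρ σ <;> simp [*, rename_upRen_upSub, Val.toTm_rename]

theorem Val.rename_subst : (v.subst σ).rename ρ = v.subst fun n => (σ n).rename ρ := by
  simp only [← Val.toTm_inj, Val.toTm_rename, Val.toTm_subst, Tm.rename_subst]

theorem subst_upSub_upSub :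
    (fun n => (upSub σ n).subst (upSub τ)) = upSub fun n => (σ n).subst τ := by
  funext n
  cases n with
  | zero => rfl
  | succ n => simp only [upSub_succ, Val.subst_rename, Val.rename_subst]; rfl

theorem Tm.subst_subst : (t.subst σ).subst τ = t.subst fun n => (σ n).subst τ := by
  induction t generalizing σ τ <;> simp [*, subst_upSub_upSub, Val.toTm_subst]

theorem Val.subst_subst : (v.subst σ).subst τ = v.subst fun n => (σ n).subst τ := by
  simp only [← Val.toTm_inj, Val.toTm_subst, Tm.subst_subst]

theorem upSub_var : upSub Val.var = Val.var := by
  funext n; cases n <;> rfl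

@[simp] theorem Tm.subst_var : t.subst .var = t := by
  induction t <;> simp [*, upSub_var]

@[simp] theorem Val.subst_var : v.subst .var = v := by
  simp only [← Val.toTm_inj, Val.toTm_subst, Tm.subst_var]

theorem Tm.rename_id : t.rename id = t := by
  rw [Tm.rename_eq_subst]; exact t.subst_var

theorem Tm.inst_subst_upSub : (t.subst (upSub σ)).inst v = t.subst (scons v σ) := by
  simp only [Tm.inst_eq_subst, Tm.subst_subst]
  congr 1; funext n
  cases n with
  | zero => rfl
  | succ n => simp only [upSub_succ, Val.subst_rename]; exact Val.subst_var _

theorem Tm.subst_inst : (t.inst v).subst σ = (t.subst (upSub σ)).inst (v.subst σ) := by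
  rw [Tm.inst_subst_upSub, Tm.inst_eq_subst, Tm.subst_subst]
  congr 1; funext n; cases n <;> rfl

end Substitution

/-! ### Contexts -/

/-- Simultaneous substitution in a pure context. -/
@[simp] def PureCtx.subst (σ : ℕ → Val) : PureCtx → PureCtx
  | .hole => .hole
  | .appR v E => .appR (v.subst σ) (E.subst σ)
  | .appL E t => .appL (E.subst σ) (t.subst σ)

/-- Simultaneous substitution in an evaluation context. -/
@[simp] def EvalCtx.subst (σ : ℕ → Val) : EvalCtx → EvalCtx
  | .hole => .hole
  | .appR v F => .appR (v.subst σ) (F.subst σ)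
  | .appL F t => .appL (F.subst σ) (t.subst σ)
  | .reset F => .reset (F.subst σ)

/-- Renaming of the free variables of an evaluation context. -/
@[simp] def EvalCtx.rename (ρ : ℕ → ℕ) : EvalCtx → EvalCtx
  | .hole => .hole
  | .appR v F => .appR (v.rename ρ) (F.rename ρ)
  | .appL F t => .appL (F.rename ρ) (t.rename ρ)
  | .reset F => .reset (F.rename ρ)

/-- Composition of pure contexts: `E.comp G` is `E[G]`. -/
@[simp] def PureCtx.comp : PureCtx → PureCtx → PureCtx
  | .hole, G => G
  | .appR v E, G => .appR v (E.comp G)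
  | .appL E t, G => .appL (E.comp G) t

section Contexts

variable (E G : PureCtx) (F H K : EvalCtx) (t : Tm) (ρ : ℕ → ℕ) (σ τ : ℕ → Val)

theorem PureCtx.rename_eq_subst : E.rename ρ = E.subst (Val.var ∘ ρ) := by
  induction E <;> simp [*, Val.rename_eq_subst, Tm.rename_eq_subst]

theorem EvalCtx.rename_eq_subst : F.rename ρ = F.subst (Val.var ∘ ρ) := by
  induction F <;> simp [*, Val.rename_eq_subst, Tm.rename_eq_subst]

theorem PureCtx.subst_subst : (E.subst σ).subst τ = E.subst fun n => (σ n).subst τ := by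
  induction E <;> simp [*, Val.subst_subst, Tm.subst_subst]

theorem EvalCtx.subst_subst : (F.subst σ).subst τ = F.subst fun n => (σ n).subst τ := by
  induction F <;> simp [*, Val.subst_subst, Tm.subst_subst]

@[simp] theorem PureCtx.subst_var : E.subst .var = E := by
  induction E <;> simp [*]

@[simp] theorem EvalCtx.subst_var : F.subst .var = F := by
  induction F <;> simp [*]

theorem PureCtx.subst_plug : (E.plug t).subst σ = (E.subst σ).plug (t.subst σ) := by
  induction E <;> simp [*, Val.toTm_subst]

theorem EvalCtx.subst_plug : (F.plug t).subst σ = (F.subst σ).plug (t.subst σ) := by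
  induction F <;> simp [*, Val.toTm_subst]

theorem PureCtx.rename_plug : (E.plug t).rename ρ = (E.rename ρ).plug (t.rename ρ) := by
  simp only [Tm.rename_eq_subst, PureCtx.rename_eq_subst, PureCtx.subst_plug]

theorem EvalCtx.rename_plug : (F.plug t).rename ρ = (F.rename ρ).plug (t.rename ρ) := by
  simp only [Tm.rename_eq_subst, EvalCtx.rename_eq_subst, EvalCtx.subst_plug]

theorem PureCtx.plug_comp : (E.comp G).plug t = E.plug (G.plug t) := by
  induction E <;> simp [*]

theorem EvalCtx.plug_comp : (F.comp H).plug t = F.plug (H.plug t) := by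
  induction F <;> simp [*]

theorem PureCtx.subst_comp : (E.comp G).subst σ = (E.subst σ).comp (G.subst σ) := by
  induction E <;> simp [*]

theorem EvalCtx.subst_comp : (F.comp H).subst σ = (F.subst σ).comp (H.subst σ) := by
  induction F <;> simp [*]

@[simp] theorem EvalCtx.comp_hole : F.comp .hole = F := by
  induction F <;> simp [*]

theorem EvalCtx.comp_assoc : (F.comp H).comp K = F.comp (H.comp K) := by
  induction F <;> simp [*]

@[simp] theorem PureCtx.plug_toEval : E.toEval.plug t = E.plug t := by
  induction E <;> simp [*]

theorem PureCtx.toEval_comp : (E.comp G).toEval = E.toEval.comp G.toEval := by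
  induction E <;> simp [*]

theorem PureCtx.toEval_subst : (E.subst σ).toEval = E.toEval.subst σ := by
  induction E <;> simp [*]

end Contexts

/-! ### Bodies: application to a fresh variable -/

/-- `v • x` for a fresh variable `x`. The fresh variable is the index `0`, the free variables of
`v` being shifted. -/
def Val.body : Val → Tm
  | .var n => .app (.var (n + 1)) (.var 0)
  | .lam t => t

/-- `E[x]` for a fresh variable `x`, encoded as in `Val.body`. -/
def PureCtx.body (E : PureCtx) : Tm := (E.rename Nat.succ).plug (.var 0)

/-- `F[x]` for a fresh variable `x`, encoded as in `Val.body`. -/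
def EvalCtx.body (F : EvalCtx) : Tm := (F.rename Nat.succ).plug (.var 0)

/-- `⟨t{λx.⟨k' E[x]⟩/k}⟩` for a fresh variable `k'`, encoded as in `Val.body`. It tests the
control stuck term `E[S k. t]`. -/
def controlBody (E : PureCtx) (t : Tm) : Tm :=
  .reset ((t.rename (upRen Nat.succ)).inst ((E.rename Nat.succ).reifyWith 0))

section Bodies

variable (E G : PureCtx) (F H : EvalCtx) (t : Tm) (v : Val) (ρ : ℕ → ℕ) (σ : ℕ → Val)

theorem PureCtx.reify_eq : E.reify = .lam (.reset E.body) := rfl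

theorem Val.body_rename : (v.rename ρ).body = v.body.rename (upRen ρ) := by
  cases v <;> rfl

theorem PureCtx.subst_rename_succ :
    (E.rename Nat.succ).subst (upSub σ) = (E.subst σ).rename Nat.succ := by
  simp only [PureCtx.rename_eq_subst, PureCtx.subst_subst]
  congr 1; funext n; exact Val.rename_eq_subst _ _

theorem PureCtx.body_subst_scons : E.body.subst (scons v σ) = (E.subst σ).plug v.toTm := by
  simp only [PureCtx.body, PureCtx.subst_plug, PureCtx.rename_eq_subst, PureCtx.subst_subst]
  rfl

theorem EvalCtx.body_subst_scons : F.body.subst (scons v σ) = (F.subst σ).plug v.toTm := by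
  simp only [EvalCtx.body, EvalCtx.subst_plug, EvalCtx.rename_eq_subst, EvalCtx.subst_subst]
  rfl

theorem PureCtx.body_subst : (E.subst σ).body = E.body.subst (upSub σ) := by
  rw [PureCtx.body, ← PureCtx.subst_rename_succ, PureCtx.body, PureCtx.subst_plug]; rfl

theorem EvalCtx.body_subst : (F.subst σ).body = F.body.subst (upSub σ) := by
  simp only [EvalCtx.body, EvalCtx.subst_plug, EvalCtx.rename_eq_subst, EvalCtx.subst_subst]
  congr 2; funext n; exact (Val.rename_eq_subst _ _).symm

theorem PureCtx.body_rename : (E.rename ρ).body = E.body.rename (upRen ρ) := by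
  rw [PureCtx.rename_eq_subst, PureCtx.body_subst, upSub_var_comp, Tm.rename_eq_subst]

theorem PureCtx.body_comp : (E.comp G).body = (E.rename Nat.succ).plug G.body := by
  simp only [PureCtx.body, PureCtx.rename_eq_subst, PureCtx.subst_comp, PureCtx.plug_comp]

theorem EvalCtx.body_comp : (F.comp H).body = (F.rename Nat.succ).plug H.body := by
  simp only [EvalCtx.body, EvalCtx.rename_eq_subst, EvalCtx.subst_comp, EvalCtx.plug_comp]

theorem PureCtx.body_inst : E.body.inst v = E.plug v.toTm := by
  rw [Tm.inst_eq_subst, PureCtx.body_subst_scons, PureCtx.subst_var]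

theorem EvalCtx.body_inst : F.body.inst v = F.plug v.toTm := by
  rw [Tm.inst_eq_subst, EvalCtx.body_subst_scons, EvalCtx.subst_var]

theorem PureCtx.reify_subst : E.reify.subst σ = (E.subst σ).reify := by
  simp only [PureCtx.reify_eq, Val.subst, Tm.subst, PureCtx.body_subst]

theorem PureCtx.reifyWith_subst (k : ℕ) :
    (E.reifyWith k).subst σ = (PureCtx.appR (σ k) (E.subst σ)).reify := by
  rw [PureCtx.reifyWith, PureCtx.reify_subst]; rfl

theorem controlBody_subst_scons :
    (controlBody E t).subst (scons v σ) =
      .reset ((t.subst (upSub σ)).inst (PureCtx.appR v (E.subst σ)).reify) := by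
  simp only [controlBody, Tm.subst, Tm.subst_inst, PureCtx.reifyWith_subst, Tm.subst_rename,
    PureCtx.rename_eq_subst, PureCtx.subst_subst, upSub_comp_upRen, scons]
  rfl

theorem controlBody_subst :
    controlBody (E.subst σ) (t.subst (upSub σ)) = (controlBody E t).subst (upSub σ) := by
  simp only [controlBody, Tm.subst, Tm.subst_inst, PureCtx.reifyWith_subst,
    PureCtx.subst_rename_succ, Tm.subst_rename, upSub_comp_upRen, Tm.rename_subst,
    rename_upRen_upSub]
  rfl

end Bodies

/-! ### Labelled reduction -/

/-- One-step reduction, labelled by the number of contexts it captures. -/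
inductive Step : ℕ → Tm → Tm → Prop
  | beta (F : EvalCtx) (t : Tm) (v : Val) :
      Step 0 (F.plug (.app (.lam t) v.toTm)) (F.plug (t.inst v))
  | capture (F : EvalCtx) (E : PureCtx) (t : Tm) :
      Step 1 (F.plug (.reset (E.plug (.shift t)))) (F.plug (.reset (t.inst E.reify)))
  | reset (F : EvalCtx) (v : Val) : Step 0 (F.plug (.reset v.toTm)) (F.plug v.toTm)

theorem red_iff_exists_step {t t' : Tm} : Red t t' ↔ ∃ c, Step c t t' := by
  constructor
  · rintro (⟨F, b, v⟩ | ⟨F, E, b⟩ | ⟨F, v⟩)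
    exacts [⟨0, .beta F b v⟩, ⟨1, .capture F E b⟩, ⟨0, .reset F v⟩]
  · rintro ⟨c, ⟨F, b, v⟩ | ⟨F, E, b⟩ | ⟨F, v⟩⟩
    exacts [.beta F b v, .shift F E b, .reset F v]

namespace Step

variable {c : ℕ} {t t' : Tm}

theorem plug (G : EvalCtx) (h : Step c t t') : Step c (G.plug t) (G.plug t') := by
  cases h with
  | beta F b v => simpa only [EvalCtx.plug_comp] using Step.beta (G.comp F) b v
  | capture F E b => simpa only [EvalCtx.plug_comp] using Step.capture (G.comp F) E b
  | reset F v => simpa only [EvalCtx.plug_comp] using Step.reset (G.comp F) v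

theorem subst (σ : ℕ → Val) (h : Step c t t') : Step c (t.subst σ) (t'.subst σ) := by
  cases h with
  | beta F b v =>
    simp only [EvalCtx.subst_plug, Tm.subst_inst, Tm.subst, ← Val.toTm_subst]
    exact .beta _ _ _
  | capture F E b =>
    simp only [EvalCtx.subst_plug, PureCtx.subst_plug, Tm.subst_inst, Tm.subst,
      PureCtx.reify_subst]
    exact .capture _ _ _
  | reset F v =>
    simp only [EvalCtx.subst_plug, Tm.subst, ← Val.toTm_subst]
    exact .reset _ _

end Step

/-! ### Unique decomposition -/

/-- The four exclusive shapes of a term: a value `v`, a control stuck term `E[S k. t]`, an open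
stuck term `F[x v]`, or a term that reduces to `t` with label `c`. -/
inductive Decomp : Type
  | value (v : Val)
  | controlStuck (E : PureCtx) (t : Tm)
  | openStuck (F : EvalCtx) (x : ℕ) (v : Val)
  | reduces (c : ℕ) (t : Tm)

/-- The decomposition of `t s` from the decompositions of `t` and `s`. -/
@[simp] def Decomp.app (t s : Tm) : Decomp → Decomp → Decomp
  | .reduces c t', _ => .reduces c (.app t' s)
  | .controlStuck E b, _ => .controlStuck (.appL E s) b
  | .openStuck F x v, _ => .openStuck (.appL F s) x v
  | .value _, .reduces c s' => .reduces c (.app t s')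
  | .value v, .controlStuck E b => .controlStuck (.appR v E) b
  | .value v, .openStuck F x u => .openStuck (.appR v F) x u
  | .value (.lam b), .value u => .reduces 0 (b.inst u)
  | .value (.var x), .value u => .openStuck .hole x u

/-- The decomposition of `⟨t⟩` from the decomposition of `t`. -/
@[simp] def Decomp.reset : Decomp → Decomp
  | .reduces c t' => .reduces c (.reset t')
  | .controlStuck E b => .reduces 1 (.reset (b.inst E.reify))
  | .openStuck F x v => .openStuck (.reset F) x v
  | .value v => .reduces 0 v.toTm

/-- The decomposition of a term. -/
@[simp] def decomp : Tm → Decomp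
  | .var n => .value (.var n)
  | .lam t => .value (.lam t)
  | .shift t => .controlStuck .hole t
  | .app t s => Decomp.app t s (decomp t) (decomp s)
  | .reset t => (decomp t).reset

/-- The decomposition describes the term. -/
inductive Decomp.Spec : Tm → Decomp → Prop
  | value (v : Val) : Spec v.toTm (.value v)
  | controlStuck (E : PureCtx) (t : Tm) : Spec (E.plug (.shift t)) (.controlStuck E t)
  | openStuck (F : EvalCtx) (x : ℕ) (v : Val) :
      Spec (F.plug (.app (.var x) v.toTm)) (.openStuck F x v)
  | reduces {c : ℕ} {t t' : Tm} : Step c t t' → Spec t (.reduces c t')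

theorem spec_decomp (t : Tm) : (decomp t).Spec t := by
  induction t with
  | var n => exact .value (.var n)
  | lam t => exact .value (.lam t)
  | shift t => exact .controlStuck .hole t
  | app t s iht ihs =>
    rw [decomp]
    generalize decomp t = d at iht
    generalize decomp s = e at ihs
    cases iht with
    | reduces h => exact .reduces (h.plug (.appL .hole s))
    | controlStuck E b => exact .controlStuck (.appL E s) b
    | openStuck F x v => exact .openStuck (.appL F s) x v
    | value v =>
      cases ihs with
      | reduces h => exact .reduces (h.plug (.appR v .hole))
      | controlStuck E b => exact .controlStuck (.appR v E) b
      | openStuck F x u => exact .openStuck (.appR v F) x u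
      | value u =>
        cases v with
        | var x => exact .openStuck .hole x u
        | lam b => exact .reduces (.beta .hole b u)
  | reset t ih =>
    rw [decomp]
    generalize decomp t = d at ih
    cases ih with
    | reduces h => exact .reduces (h.plug (.reset .hole))
    | controlStuck E b => exact .reduces (.capture .hole E b)
    | openStuck F x v => exact .openStuck (.reset F) x v
    | value v => exact .reduces (.reset .hole v)

@[simp] theorem decomp_toTm (v : Val) : decomp v.toTm = .value v := by
  cases v <;> rfl

@[simp] theorem decomp_plug_shift (E : PureCtx) (t : Tm) :
    decomp (E.plug (.shift t)) = .controlStuck E t := by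
  induction E <;> simp [*]

@[simp] theorem decomp_plug_app_var (F : EvalCtx) (x : ℕ) (v : Val) :
    decomp (F.plug (.app (.var x) v.toTm)) = .openStuck F x v := by
  induction F <;> simp [*]

theorem decomp_plug_of_reduces {c : ℕ} {t t' : Tm} (F : EvalCtx)
    (h : decomp t = .reduces c t') : decomp (F.plug t) = .reduces c (F.plug t') := by
  induction F <;> simp [*]

theorem step_iff_decomp {c : ℕ} {t t' : Tm} : Step c t t' ↔ decomp t = .reduces c t' := by
  constructor
  · rintro (⟨F, b, v⟩ | ⟨F, E, b⟩ | ⟨F, v⟩) <;> exact decomp_plug_of_reduces F (by simp)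
  · intro h
    have hs := spec_decomp t
    rw [h] at hs
    cases hs with
    | reduces hs => exact hs

namespace Step

variable {c d : ℕ} {t s r t₁ t₂ : Tm}

theorem det (h₁ : Step c t t₁) (h₂ : Step d t t₂) : c = d ∧ t₁ = t₂ := by
  simpa [step_iff_decomp.1 h₁] using step_iff_decomp.1 h₂

theorem app_inv (h : Step c (.app t s) r) :
    (∃ t', Step c t t' ∧ r = .app t' s) ∨
    (∃ v s', t = Val.toTm v ∧ Step c s s' ∧ r = .app t s') ∨
    (∃ b v, t = .lam b ∧ s = Val.toTm v ∧ c = 0 ∧ r = b.inst v) := by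
  rw [step_iff_decomp, decomp] at h
  have ht := spec_decomp t
  have hs := spec_decomp s
  generalize decomp t = d at *
  generalize decomp s = e at *
  rcases ht with v | _ | _ | ht
  · rcases hs with u | _ | _ | hs
    · cases v with
      | var x => simp at h
      | lam b =>
        simp only [Decomp.app, Decomp.reduces.injEq] at h
        exact .inr (.inr ⟨b, u, rfl, rfl, h.1.symm, h.2.symm⟩)
    · simp at h
    · simp at h
    · simp only [Decomp.app, Decomp.reduces.injEq] at h
      exact .inr (.inl ⟨v, _, rfl, h.1 ▸ hs, h.2.symm⟩)
  · simp at h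
  · simp at h
  · simp only [Decomp.app, Decomp.reduces.injEq] at h
    exact .inl ⟨_, h.1 ▸ ht, h.2.symm⟩

theorem reset_inv (h : Step c (.reset t) r) :
    (∃ t', Step c t t' ∧ r = .reset t') ∨
    (∃ E b, t = PureCtx.plug E (.shift b) ∧ c = 1 ∧ r = .reset (b.inst E.reify)) ∨
    (∃ v, t = Val.toTm v ∧ c = 0 ∧ r = t) := by
  rw [step_iff_decomp, decomp] at h
  have ht := spec_decomp t
  generalize decomp t = d at *
  rcases ht with v | ⟨E, b⟩ | _ | ht
  · simp only [Decomp.reset, Decomp.reduces.injEq] at h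
    exact .inr (.inr ⟨v, rfl, h.1.symm, h.2.symm⟩)
  · simp only [Decomp.reset, Decomp.reduces.injEq] at h
    exact .inr (.inl ⟨E, b, rfl, h.1.symm, h.2.symm⟩)
  · simp at h
  · simp only [Decomp.reset, Decomp.reduces.injEq] at h
    exact .inl ⟨_, h.1 ▸ ht, h.2.symm⟩

end Step

/-! ### Normal forms -/

/-- Irreducible terms. -/
def Tm.IsNormal (t : Tm) : Prop := ∀ t', ¬ Red t t'

theorem Tm.IsNormal.not_step {c : ℕ} {t t' : Tm} (h : t.IsNormal) : ¬ Step c t t' :=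
  fun hs => h t' (red_iff_exists_step.2 ⟨c, hs⟩)

theorem Tm.isNormal_or_exists_step (t : Tm) : t.IsNormal ∨ ∃ c t', Step c t t' := by
  by_contra! ⟨h, h'⟩
  exact h fun t' hr => (red_iff_exists_step.1 hr).elim fun c hs => h' c t' hs

theorem isNormal_of_decomp {t : Tm} (h : ∀ c t', decomp t ≠ .reduces c t') : t.IsNormal :=
  fun t' hr => (red_iff_exists_step.1 hr).elim fun c hs => h c t' (step_iff_decomp.1 hs)

theorem isNormal_toTm (v : Val) : v.toTm.IsNormal := isNormal_of_decomp (by simp)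

theorem isNormal_plug_shift (E : PureCtx) (t : Tm) : (E.plug (.shift t)).IsNormal :=
  isNormal_of_decomp (by simp)

theorem isNormal_plug_app_var (F : EvalCtx) (x : ℕ) (v : Val) :
    (F.plug (.app (.var x) v.toTm)).IsNormal :=
  isNormal_of_decomp (by simp)

@[elab_as_elim]
theorem Tm.IsNormal.induct {motive : (t : Tm) → t.IsNormal → Prop} {t : Tm} (h : t.IsNormal)
    (value : ∀ v : Val, motive v.toTm (isNormal_toTm v))
    (controlStuck : ∀ (E : PureCtx) (b : Tm),
      motive (E.plug (.shift b)) (isNormal_plug_shift E b))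
    (openStuck : ∀ (F : EvalCtx) (x : ℕ) (v : Val),
      motive (F.plug (.app (.var x) v.toTm)) (isNormal_plug_app_var F x v)) :
    motive t h := by
  have hs := spec_decomp t
  generalize decomp t = d at hs
  cases hs with
  | value v => exact value v
  | controlStuck E b => exact controlStuck E b
  | openStuck F x v => exact openStuck F x v
  | reduces hs => exact absurd hs h.not_step

theorem Tm.IsNormal.rename {t : Tm} (h : t.IsNormal) (ρ : ℕ → ℕ) : (t.rename ρ).IsNormal := by
  cases h using Tm.IsNormal.induct with
  | value v => rw [← Val.toTm_rename]; exact isNormal_toTm _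
  | controlStuck E b => rw [PureCtx.rename_plug]; exact isNormal_plug_shift _ _
  | openStuck F x v =>
    simp only [EvalCtx.rename_plug, Tm.rename, ← Val.toTm_rename]
    exact isNormal_plug_app_var _ _ _

/-! ### Reduction sequences -/

/-- `Steps s n t t'`: the term `t` reduces to `t'` in `n` steps, among which `s` steps capture a
context. -/
inductive Steps : ℕ → ℕ → Tm → Tm → Prop
  | refl (t : Tm) : Steps 0 0 t t
  | head {c s n : ℕ} {t u w : Tm} :
      Step c t u → Steps s n u w → Steps (c + s) (n + 1) t w

namespace Steps

variable {s s₁ s₂ n n₁ n₂ : ℕ} {t t' t₁ t₂ t₃ : Tm}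

theorem single (h : Step s t t') : Steps s 1 t t' := .head h (.refl _)

theorem trans (h₁ : Steps s₁ n₁ t₁ t₂) (h₂ : Steps s₂ n₂ t₂ t₃) :
    Steps (s₁ + s₂) (n₁ + n₂) t₁ t₃ := by
  induction h₁ with
  | refl t => simpa only [zero_add] using h₂
  | head h _ ih =>
    rw [add_assoc, add_right_comm]
    exact .head h (ih h₂)

theorem plug (F : EvalCtx) (h : Steps s n t t') : Steps s n (F.plug t) (F.plug t') := by
  induction h with
  | refl t => exact .refl _
  | head h _ ih => exact .head (h.plug F) ih

theorem subst (h : Steps s n t t') (σ : ℕ → Val) : Steps s n (t.subst σ) (t'.subst σ) := by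
  induction h with
  | refl t => exact .refl _
  | head h _ ih => exact .head (h.subst σ) ih

theorem eq_of_isNormal (h : Steps s n t t') (ht : t.IsNormal) : t' = t := by
  cases h with
  | refl => rfl
  | head h _ => exact absurd h ht.not_step

theorem cancel (h₁ : Steps s₁ n₁ t t₁) (h₂ : Steps s₂ n₂ t t₂) (hn : t₂.IsNormal) :
    ∃ s n, Steps s n t₁ t₂ ∧ s₂ = s₁ + s ∧ n₂ = n₁ + n := by
  induction h₁ generalizing s₂ n₂ with
  | refl t => exact ⟨s₂, n₂, h₂, by simp⟩
  | head h _ ih =>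
    cases h₂ with
    | refl => exact absurd h hn.not_step
    | head h' h₂' =>
      obtain ⟨rfl, rfl⟩ := h.det h'
      obtain ⟨s', n', h1, rfl, rfl⟩ := ih h₂'
      exact ⟨s', n', h1, by ring, by ring⟩

theorem reflect {f : Tm → Tm} (hf : ∀ {c t t'}, Step c t t' → Step c (f t) (f t'))
    (h : Steps s n (f t) t') (hn : t'.IsNormal) :
    ∃ s₁ n₁ s₂ n₂ u, Steps s₁ n₁ t u ∧ u.IsNormal ∧ Steps s₂ n₂ (f u) t' ∧ s = s₁ + s₂ ∧
      n = n₁ + n₂ := by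
  induction n using Nat.strong_induction_on generalizing s t with
  | _ n ih =>
    rcases t.isNormal_or_exists_step with ht | ⟨c, u, hu⟩
    · exact ⟨0, 0, s, n, t, .refl _, ht, h, by simp⟩
    · obtain ⟨s', n', h', rfl, rfl⟩ := (Steps.single (hf hu)).cancel h hn
      obtain ⟨s₁, n₁, s₂, n₂, w, h₁, hw, h₂, rfl, rfl⟩ := ih n' (by omega) h'
      exact ⟨_, _, _, _, w, .head hu h₁, hw, h₂, by ring, by ring⟩

end Steps

section Eval

variable {s n : ℕ} {t t' t₁ t₂ : Tm}

theorem reflTransGen_red_iff : Relation.ReflTransGen Red t t' ↔ ∃ s n, Steps s n t t' := by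
  constructor
  · intro h
    induction h using Relation.ReflTransGen.head_induction_on with
    | refl => exact ⟨0, 0, .refl _⟩
    | head h _ ih =>
      obtain ⟨s, n, hs⟩ := ih
      obtain ⟨c, hc⟩ := red_iff_exists_step.1 h
      exact ⟨_, _, .head hc hs⟩
  · rintro ⟨s, n, h⟩
    induction h with
    | refl => exact .refl
    | head h _ ih => exact .head (red_iff_exists_step.2 ⟨_, h⟩) ih

theorem eval_iff : Eval t t' ↔ (∃ s n, Steps s n t t') ∧ t'.IsNormal := by
  rw [Eval, reflTransGen_red_iff, Tm.IsNormal]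

theorem Steps.eval (h : Steps s n t t₁) (hn : Eval t₁ t₂) : Eval t t₂ :=
  ⟨(reflTransGen_red_iff.2 ⟨s, n, h⟩).trans hn.1, hn.2⟩

theorem Tm.IsNormal.eval (h : t.IsNormal) : Eval t t := ⟨.refl, h⟩

theorem Eval.unique (h₁ : Eval t t₁) (h₂ : Eval t t₂) : t₁ = t₂ := by
  obtain ⟨⟨_, _, h₁⟩, hn₁⟩ := eval_iff.1 h₁
  obtain ⟨⟨_, _, h₂⟩, hn₂⟩ := eval_iff.1 h₂
  obtain ⟨_, _, h, -, -⟩ := h₁.cancel h₂ hn₂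
  exact (h.eq_of_isNormal hn₁).symm

end Eval

/-! ### Normal form relations with a canonical fresh variable -/

/-- `CtxRel` with the canonical fresh variable of `PureCtx.body` and `EvalCtx.body`. -/
inductive FreshCtxRel (R : Tm → Tm → Prop) : EvalCtx → EvalCtx → Prop
  | pure {E₀ E₁ : PureCtx} : R E₀.body E₁.body → FreshCtxRel R E₀.toEval E₁.toEval
  | delimited {F₀ F₁ : EvalCtx} {E₀ E₁ : PureCtx} :
      R F₀.body F₁.body → R (.reset E₀.body) (.reset E₁.body) →
      FreshCtxRel R (F₀.comp (.reset E₀.toEval)) (F₁.comp (.reset E₁.toEval))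

/-- `RefinedNF` with the canonical fresh variable of `Val.body`, `PureCtx.body`, `EvalCtx.body`
and `controlBody`. -/
inductive FreshNF (R : Tm → Tm → Prop) : Tm → Tm → Prop
  | value {v₀ v₁ : Val} : R v₀.body v₁.body → FreshNF R v₀.toTm v₁.toTm
  | controlStuck {E₀ E₁ : PureCtx} {t₀ t₁ : Tm} :
      R (controlBody E₀ t₀) (controlBody E₁ t₁) →
      FreshNF R (E₀.plug (.shift t₀)) (E₁.plug (.shift t₁))
  | openStuck {F₀ F₁ : EvalCtx} {x : ℕ} {v₀ v₁ : Val} :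
      FreshCtxRel R F₀ F₁ → R v₀.body v₁.body →
      FreshNF R (F₀.plug (.app (.var x) v₀.toTm)) (F₁.plug (.app (.var x) v₁.toTm))

/-- The decomposition of an evaluation context at its innermost reset. -/
def EvalCtx.split : EvalCtx → Option EvalCtx × PureCtx
  | .hole => (none, .hole)
  | .appR v F => match F.split with
    | (none, E) => (none, .appR v E)
    | (some G, E) => (some (.appR v G), E)
  | .appL F t => match F.split with
    | (none, E) => (none, .appL E t)
    | (some G, E) => (some (.appL G t), E)
  | .reset F => match F.split with
    | (none, E) => (some .hole, E)
    | (some G, E) => (some (.reset G), E)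

@[simp] theorem PureCtx.split_toEval (E : PureCtx) : E.toEval.split = (none, E) := by
  induction E <;> simp [EvalCtx.split, *]

@[simp] theorem EvalCtx.split_comp (F : EvalCtx) (E : PureCtx) :
    (F.comp (.reset E.toEval)).split = (some F, E) := by
  induction F <;> simp [EvalCtx.split, *]

theorem EvalCtx.pure_or_delimited (F : EvalCtx) :
    (∃ E : PureCtx, F = E.toEval) ∨
      ∃ (G : EvalCtx) (E : PureCtx), F = G.comp (.reset E.toEval) := by
  induction F with
  | hole => exact .inl ⟨.hole, rfl⟩
  | appR v F ih =>
    rcases ih with ⟨E, rfl⟩ | ⟨G, E, rfl⟩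
    exacts [.inl ⟨.appR v E, rfl⟩, .inr ⟨.appR v G, E, rfl⟩]
  | appL F t ih =>
    rcases ih with ⟨E, rfl⟩ | ⟨G, E, rfl⟩
    exacts [.inl ⟨.appL E t, rfl⟩, .inr ⟨.appL G t, E, rfl⟩]
  | reset F ih =>
    rcases ih with ⟨E, rfl⟩ | ⟨G, E, rfl⟩
    exacts [.inr ⟨.hole, E, rfl⟩, .inr ⟨.reset G, E, rfl⟩]

section FreshNF

variable {R S : Tm → Tm → Prop} {F G H : EvalCtx} {p q r : Tm}

theorem FreshCtxRel.mono (hRS : ∀ a b, R a b → S a b) (h : FreshCtxRel R F G) :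
    FreshCtxRel S F G := by
  cases h with
  | pure h => exact .pure (hRS _ _ h)
  | delimited h h' => exact .delimited (hRS _ _ h) (hRS _ _ h')

theorem FreshNF.mono (hRS : ∀ a b, R a b → S a b) (h : FreshNF R p q) : FreshNF S p q := by
  cases h with
  | value h => exact .value (hRS _ _ h)
  | controlStuck h => exact .controlStuck (hRS _ _ h)
  | openStuck hF hv => exact .openStuck (hF.mono hRS) (hRS _ _ hv)

theorem FreshCtxRel.flip (h : FreshCtxRel R F G) : FreshCtxRel (fun a b => R b a) G F := by
  cases h with
  | pure h => exact .pure h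
  | delimited h h' => exact .delimited h h'

theorem FreshNF.flip (h : FreshNF R p q) : FreshNF (fun a b => R b a) q p := by
  cases h with
  | value h => exact .value h
  | controlStuck h => exact .controlStuck h
  | openStuck hF hv => exact .openStuck hF.flip hv

theorem FreshCtxRel.refl (hR : ∀ t, R t t) (F : EvalCtx) : FreshCtxRel R F F := by
  rcases F.pure_or_delimited with ⟨E, rfl⟩ | ⟨G, E, rfl⟩
  exacts [.pure (hR _), .delimited (hR _) (hR _)]

theorem FreshNF.refl (hR : ∀ t, R t t) (hp : p.IsNormal) : FreshNF R p p := by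
  cases hp using Tm.IsNormal.induct with
  | value v => exact .value (hR _)
  | controlStuck E b => exact .controlStuck (hR _)
  | openStuck F x v => exact .openStuck (.refl hR F) (hR _)

theorem FreshCtxRel.trans (h₁ : FreshCtxRel R F G) (h₂ : FreshCtxRel S G H) :
    FreshCtxRel (Relation.Comp R S) F H := by
  generalize hG : G = G' at h₂
  cases h₁ with
  | pure h₁ =>
    cases h₂ with
    | pure h₂ =>
      obtain rfl : _ = _ := by simpa using congrArg EvalCtx.split hG
      exact .pure ⟨_, h₁, h₂⟩
    | delimited => simpa using congrArg EvalCtx.split hG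
  | delimited h₁ h₁' =>
    cases h₂ with
    | pure => simpa using congrArg EvalCtx.split hG
    | delimited h₂ h₂' =>
      obtain ⟨rfl, rfl⟩ : _ ∧ _ := by simpa using congrArg EvalCtx.split hG
      exact .delimited ⟨_, h₁, h₂⟩ ⟨_, h₁', h₂'⟩

theorem FreshNF.trans (h₁ : FreshNF R p q) (h₂ : FreshNF S q r) :
    FreshNF (Relation.Comp R S) p r := by
  generalize hq : q = q' at h₂
  cases h₁ with
  | value h₁ =>
    cases h₂ with
    | value h₂ =>
      obtain rfl : _ = _ := by simpa using congrArg decomp hq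
      exact .value ⟨_, h₁, h₂⟩
    | _ => simpa using congrArg decomp hq
  | controlStuck h₁ =>
    cases h₂ with
    | controlStuck h₂ =>
      obtain ⟨rfl, rfl⟩ : _ ∧ _ := by simpa using congrArg decomp hq
      exact .controlStuck ⟨_, h₁, h₂⟩
    | _ => simpa using congrArg decomp hq
  | openStuck hF₁ hv₁ =>
    cases h₂ with
    | openStuck hF₂ hv₂ =>
      obtain ⟨rfl, rfl, rfl⟩ : _ ∧ _ ∧ _ := by simpa using congrArg decomp hq
      exact .openStuck (hF₁.trans hF₂) ⟨_, hv₁, hv₂⟩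
    | _ => simpa using congrArg decomp hq

end FreshNF

/-! ### Free variables -/

attribute [simp] Tm.Free PureCtx.Free EvalCtx.Free

section Free

variable {t : Tm} {E : PureCtx} {F : EvalCtx} {σ τ : ℕ → Val} {ρ ξ : ℕ → ℕ} {x : ℕ}

theorem upSub_congr (h : ∀ x, t.Free (x + 1) → σ x = τ x) :
    ∀ x, t.Free x → upSub σ x = upSub τ x
  | 0, _ => rfl
  | x + 1, hx => congrArg (Val.rename Nat.succ) (h x hx)

theorem Tm.subst_congr (h : ∀ x, t.Free x → σ x = τ x) : t.subst σ = t.subst τ := by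
  induction t generalizing σ τ with
  | var n => exact congrArg Val.toTm (h n rfl)
  | lam t ih => exact congrArg Tm.lam (ih (upSub_congr h))
  | shift t ih => exact congrArg Tm.shift (ih (upSub_congr h))
  | reset t ih => exact congrArg Tm.reset (ih h)
  | app t s iht ihs =>
    exact congrArg₂ Tm.app (iht fun x hx => h x (.inl hx)) (ihs fun x hx => h x (.inr hx))

theorem Val.subst_congr {v : Val} (h : ∀ x, v.toTm.Free x → σ x = τ x) :
    v.subst σ = v.subst τ := by
  rw [← Val.toTm_inj, Val.toTm_subst, Val.toTm_subst, Tm.subst_congr h]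

theorem PureCtx.subst_congr (h : ∀ x, E.Free x → σ x = τ x) : E.subst σ = E.subst τ := by
  induction E with
  | hole => rfl
  | appR v E ih =>
    exact congrArg₂ PureCtx.appR (Val.subst_congr fun x hx => h x (.inl hx))
      (ih fun x hx => h x (.inr hx))
  | appL E t ih =>
    exact congrArg₂ PureCtx.appL (ih fun x hx => h x (.inl hx))
      (Tm.subst_congr fun x hx => h x (.inr hx))

theorem EvalCtx.subst_congr (h : ∀ x, F.Free x → σ x = τ x) : F.subst σ = F.subst τ := by
  induction F with
  | hole => rfl
  | appR v F ih =>
    exact congrArg₂ EvalCtx.appR (Val.subst_congr fun x hx => h x (.inl hx))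
      (ih fun x hx => h x (.inr hx))
  | appL F t ih =>
    exact congrArg₂ EvalCtx.appL (ih fun x hx => h x (.inl hx))
      (Tm.subst_congr fun x hx => h x (.inr hx))
  | reset F ih => exact congrArg EvalCtx.reset (ih h)

theorem Tm.rename_congr (h : ∀ x, t.Free x → ρ x = ξ x) : t.rename ρ = t.rename ξ := by
  simp only [Tm.rename_eq_subst]
  exact Tm.subst_congr fun x hx => congrArg Val.var (h x hx)

theorem PureCtx.free_plug : (E.plug t).Free x ↔ E.Free x ∨ t.Free x := by
  induction E <;> simp [*] <;> tauto

theorem EvalCtx.free_plug : (F.plug t).Free x ↔ F.Free x ∨ t.Free x := by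
  induction F <;> simp [*] <;> tauto

theorem Tm.finite_free (t : Tm) : {x | t.Free x}.Finite := by
  induction t with
  | var n => exact Set.finite_singleton n
  | lam t ih => exact ih.preimage Nat.succ_injective.injOn
  | shift t ih => exact ih.preimage Nat.succ_injective.injOn
  | reset _ ih => exact ih
  | app t s iht ihs => exact iht.union ihs

theorem exists_fresh (t s : Tm) : ∃ x, ¬ t.Free x ∧ ¬ s.Free x := by
  obtain ⟨x, hx⟩ := (t.finite_free.union s.finite_free).exists_notMem
  exact ⟨x, not_or.1 hx⟩

theorem bindRen_self (x : ℕ) : bindRen x x = 0 := if_pos rfl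

theorem bindRen_of_ne {x n : ℕ} (h : n ≠ x) : bindRen x n = n + 1 := if_neg h

/-- The renaming that replaces the variable bound by an enclosing binder by `x`; it is inverse to
`bindRen x` on terms where `x` is fresh. -/
def unbindRen (x : ℕ) : ℕ → ℕ
  | 0 => x
  | n + 1 => n

theorem PureCtx.rename_bindRen (h : ¬ E.Free x) : E.rename (bindRen x) = E.rename Nat.succ := by
  simp only [PureCtx.rename_eq_subst]
  exact PureCtx.subst_congr fun _ hy =>
    congrArg Val.var (bindRen_of_ne fun hyx => h (hyx ▸ hy))

theorem EvalCtx.rename_bindRen (h : ¬ F.Free x) : F.rename (bindRen x) = F.rename Nat.succ := by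
  simp only [EvalCtx.rename_eq_subst]
  exact EvalCtx.subst_congr fun _ hy =>
    congrArg Val.var (bindRen_of_ne fun hyx => h (hyx ▸ hy))

theorem PureCtx.plug_var_rename_bindRen (h : ¬ E.Free x) :
    (E.plug (.var x)).rename (bindRen x) = E.body := by
  rw [PureCtx.rename_plug, PureCtx.body, PureCtx.rename_bindRen h, Tm.rename, bindRen_self]

theorem EvalCtx.plug_var_rename_bindRen (h : ¬ F.Free x) :
    (F.plug (.var x)).rename (bindRen x) = F.body := by
  rw [EvalCtx.rename_plug, EvalCtx.body, EvalCtx.rename_bindRen h, Tm.rename, bindRen_self]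

theorem Tm.inst_var (t : Tm) (x : ℕ) : t.inst (.var x) = t.rename (unbindRen x) := by
  rw [Tm.inst_eq_subst, Tm.rename_eq_subst]; congr 1; funext n; cases n <;> rfl

theorem Val.appVar_rename_bindRen {v : Val} (h : ¬ v.toTm.Free x) :
    (v.appVar x).rename (bindRen x) = v.body := by
  cases v with
  | var n => simp [Val.appVar, Val.body, bindRen_self, bindRen_of_ne (Ne.symm h)]
  | lam t =>
    rw [Val.appVar, Tm.inst_var, Tm.rename_rename, Val.body]
    refine (Tm.rename_congr fun y hy => ?_).trans t.rename_id
    cases y with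
    | zero => exact bindRen_self x
    | succ y => exact bindRen_of_ne fun hyx => h (hyx ▸ hy)

theorem controlBody_eq_rename_bindRen (h : ¬ (E.plug (.shift t)).Free x) :
    (Tm.reset (t.inst (E.reifyWith x))).rename (bindRen x) = controlBody E t := by
  rw [PureCtx.free_plug, not_or] at h
  have ht : t.rename (upRen (bindRen x)) = t.rename (upRen Nat.succ) := by
    refine Tm.rename_congr fun y hy => ?_
    cases y with
    | zero => rfl
    | succ y => exact congrArg Nat.succ (bindRen_of_ne fun hyx => h.2 (hyx ▸ hy))
  rw [Tm.rename_eq_subst, Tm.subst, Tm.subst_inst, PureCtx.reifyWith_subst, upSub_var_comp,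
    ← Tm.rename_eq_subst, ← PureCtx.rename_eq_subst, PureCtx.rename_bindRen h.1, ht,
    Function.comp_apply, bindRen_self]
  rfl

theorem PureCtx.body_rename_unbindRen (E : PureCtx) (x : ℕ) :
    E.body.rename (unbindRen x) = E.plug (.var x) := by
  rw [← Tm.inst_var, PureCtx.body_inst, Val.toTm_var]

theorem EvalCtx.body_rename_unbindRen (F : EvalCtx) (x : ℕ) :
    F.body.rename (unbindRen x) = F.plug (.var x) := by
  rw [← Tm.inst_var, EvalCtx.body_inst, Val.toTm_var]

theorem Val.body_rename_unbindRen (v : Val) (x : ℕ) :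
    v.body.rename (unbindRen x) = v.appVar x := by
  cases v with
  | var n => rfl
  | lam t => exact (Tm.inst_var t x).symm

theorem controlBody_rename_unbindRen (E : PureCtx) (t : Tm) (x : ℕ) :
    (controlBody E t).rename (unbindRen x) = .reset (t.inst (E.reifyWith x)) := by
  rw [← Tm.inst_var, Tm.inst_eq_subst, controlBody_subst_scons, upSub_var, Tm.subst_var,
    PureCtx.subst_var]
  rfl

end Free

/-! ### Relations closed under renaming -/

/-- Closure under renaming. For such relations the choice of the fresh variable in `RefinedNF` is
irrelevant. -/
def RenClosed (R : Tm → Tm → Prop) : Prop :=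
  ∀ a b ρ, R a b → R (a.rename ρ) (b.rename ρ)

/-- The least relation that contains `R` and is closed under renaming. -/
inductive RenClosure (R : Tm → Tm → Prop) : Tm → Tm → Prop
  | rename {a b : Tm} (ρ : ℕ → ℕ) : R a b → RenClosure R (a.rename ρ) (b.rename ρ)

section RenClosed

variable {R : Tm → Tm → Prop} {p q : Tm} {F₀ F₁ : EvalCtx} {v₀ v₁ : Val}

theorem RenClosure.renClosed : RenClosed (RenClosure R) := by
  rintro _ _ ξ ⟨ρ, h⟩
  simp only [Tm.rename_rename]
  exact .rename _ h

theorem ValRel.renClosure_body (h : ValRel R v₀ v₁) : RenClosure R v₀.body v₁.body := by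
  obtain ⟨x, h₀, h₁, h⟩ := h
  rw [← Val.appVar_rename_bindRen h₀, ← Val.appVar_rename_bindRen h₁]
  exact .rename _ h

theorem CtxRel.toFreshCtxRel (h : CtxRel R F₀ F₁) : FreshCtxRel (RenClosure R) F₀ F₁ := by
  cases h with
  | pure E₀ E₁ x h₀ h₁ h =>
    refine .pure ?_
    rw [← PureCtx.plug_var_rename_bindRen h₀, ← PureCtx.plug_var_rename_bindRen h₁]
    exact .rename _ h
  | delimited F₀ F₁ E₀ E₁ x hF₀ hF₁ hE₀ hE₁ hF hE =>
    refine .delimited ?_ ?_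
    · rw [← EvalCtx.plug_var_rename_bindRen hF₀, ← EvalCtx.plug_var_rename_bindRen hF₁]
      exact .rename _ hF
    · rw [← PureCtx.plug_var_rename_bindRen hE₀, ← PureCtx.plug_var_rename_bindRen hE₁]
      exact .rename (bindRen x) hE

theorem RefinedNF.toFreshNF (h : RefinedNF R p q) : FreshNF (RenClosure R) p q := by
  cases h with
  | value v₀ v₁ h => exact .value h.renClosure_body
  | control E₀ E₁ t₀ t₁ k h₀ h₁ h =>
    refine .controlStuck ?_
    rw [← controlBody_eq_rename_bindRen h₀, ← controlBody_eq_rename_bindRen h₁]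
    exact .rename _ h
  | openStuck x F₀ F₁ v₀ v₁ hF hv => exact .openStuck hF.toFreshCtxRel hv.renClosure_body

theorem RenClosed.valRel (hR : RenClosed R) (h : R v₀.body v₁.body) : ValRel R v₀ v₁ := by
  obtain ⟨x, h₀, h₁⟩ := exists_fresh v₀.toTm v₁.toTm
  refine ⟨x, h₀, h₁, ?_⟩
  simpa only [Val.body_rename_unbindRen] using hR _ _ (unbindRen x) h

theorem FreshCtxRel.toCtxRel (hR : RenClosed R) (h : FreshCtxRel R F₀ F₁) :
    CtxRel R F₀ F₁ := by
  cases h with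
  | @pure E₀ E₁ h =>
    obtain ⟨x, h₀, h₁⟩ := exists_fresh (E₀.plug (.var 0)) (E₁.plug (.var 0))
    rw [PureCtx.free_plug, not_or] at h₀ h₁
    refine .pure _ _ x h₀.1 h₁.1 ?_
    simpa only [PureCtx.body_rename_unbindRen] using hR _ _ (unbindRen x) h
  | @delimited F₀ F₁ E₀ E₁ hF hE =>
    obtain ⟨x, h₀, h₁⟩ :=
      exists_fresh (F₀.plug (E₀.plug (.var 0))) (F₁.plug (E₁.plug (.var 0)))
    rw [EvalCtx.free_plug, PureCtx.free_plug, not_or, not_or] at h₀ h₁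
    refine .delimited _ _ _ _ x h₀.1 h₁.1 h₀.2.1 h₁.2.1 ?_ ?_
    · simpa only [EvalCtx.body_rename_unbindRen] using hR _ _ (unbindRen x) hF
    · simpa only [Tm.rename, PureCtx.body_rename_unbindRen] using hR _ _ (unbindRen x) hE

theorem FreshNF.toRefinedNF (hR : RenClosed R) (h : FreshNF R p q) : RefinedNF R p q := by
  cases h with
  | value h => exact .value _ _ (hR.valRel h)
  | @controlStuck E₀ E₁ t₀ t₁ h =>
    obtain ⟨k, h₀, h₁⟩ := exists_fresh (E₀.plug (.shift t₀)) (E₁.plug (.shift t₁))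
    refine .control _ _ _ _ k h₀ h₁ ?_
    simpa only [controlBody_rename_unbindRen] using hR _ _ (unbindRen k) h
  | openStuck hF hv => exact .openStuck _ _ _ _ _ (hF.toCtxRel hR) (hR.valRel hv)

theorem FreshCtxRel.rename (hR : RenClosed R) (h : FreshCtxRel R F₀ F₁) (ρ : ℕ → ℕ) :
    FreshCtxRel R (F₀.rename ρ) (F₁.rename ρ) := by
  cases h with
  | pure h =>
    simp only [EvalCtx.rename_eq_subst, ← PureCtx.toEval_subst, ← PureCtx.rename_eq_subst]
    refine .pure ?_
    simpa only [PureCtx.body_rename] using hR _ _ (upRen ρ) h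
  | delimited hF hE =>
    simp only [EvalCtx.rename_eq_subst, EvalCtx.subst_comp, EvalCtx.subst, ← PureCtx.toEval_subst,
      ← PureCtx.rename_eq_subst]
    refine .delimited ?_ ?_
    · simpa only [EvalCtx.body_subst, upSub_var_comp, Tm.rename_eq_subst] using
        hR _ _ (upRen ρ) hF
    · simpa only [Tm.rename, PureCtx.body_rename] using hR _ _ (upRen ρ) hE

theorem FreshNF.rename (hR : RenClosed R) (h : FreshNF R p q) (ρ : ℕ → ℕ) :
    FreshNF R (p.rename ρ) (q.rename ρ) := by
  cases h with
  | value h =>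
    simp only [← Val.toTm_rename]
    refine .value ?_
    simpa only [Val.body_rename] using hR _ _ (upRen ρ) h
  | controlStuck h =>
    simp only [Tm.rename_eq_subst, PureCtx.subst_plug, Tm.subst]
    refine .controlStuck ?_
    rw [controlBody_subst, controlBody_subst, upSub_var_comp, ← Tm.rename_eq_subst,
      ← Tm.rename_eq_subst]
    exact hR _ _ (upRen ρ) h
  | openStuck hF hv =>
    simp only [EvalCtx.rename_plug, Tm.rename, ← Val.toTm_rename]
    refine .openStuck (hF.rename hR ρ) ?_
    simpa only [Val.body_rename] using hR _ _ (upRen ρ) hv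

end RenClosed

/-! ### Bisimilarity is an equivalence relation closed under renaming -/

theorem isRefinedSimulation_of_renClosed {R : Tm → Tm → Prop} (hR : RenClosed R)
    (h : ∀ p q p', R p q → Eval p p' → ∃ q', Eval q q' ∧ FreshNF R p' q') :
    IsRefinedSimulation R := by
  intro p q p' hpq hp
  obtain ⟨q', hq, hn⟩ := h p q p' hpq hp
  exact ⟨q', hq, hn.toRefinedNF hR⟩

theorem Eval.rename {t u : Tm} (h : Eval t u) (ρ : ℕ → ℕ) :
    Eval (t.rename ρ) (u.rename ρ) := by
  obtain ⟨⟨s, n, hs⟩, hn⟩ := eval_iff.1 h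
  refine eval_iff.2 ⟨⟨s, n, ?_⟩, hn.rename ρ⟩
  simpa only [Tm.rename_eq_subst] using hs.subst _

theorem Eval.reflect_rename {t u : Tm} {ρ : ℕ → ℕ} (h : Eval (t.rename ρ) u) :
    ∃ t', Eval t t' ∧ u = t'.rename ρ := by
  obtain ⟨⟨s, n, hs⟩, hn⟩ := eval_iff.1 h
  rw [Tm.rename_eq_subst] at hs
  obtain ⟨s₁, n₁, s₂, n₂, t', h₁, ht', h₂, -, -⟩ := hs.reflect (Step.subst _) hn
  rw [← Tm.rename_eq_subst] at h₂
  exact ⟨t', eval_iff.2 ⟨⟨s₁, n₁, h₁⟩, ht'⟩, h₂.eq_of_isNormal (ht'.rename ρ)⟩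

namespace RefinedBisimilar

variable {R : Tm → Tm → Prop} {p q r p' : Tm}

theorem symm (h : RefinedBisimilar p q) : RefinedBisimilar q p := by
  obtain ⟨R, hR, h⟩ := h
  exact ⟨fun a b => R b a, ⟨hR.2, hR.1⟩, h⟩

theorem of_symmetric (hR : RenClosed R) (hs : ∀ p q, R p q → R q p)
    (h : ∀ p q p', R p q → Eval p p' → ∃ q', Eval q q' ∧ FreshNF R p' q') (hpq : R p q) :
    RefinedBisimilar p q := by
  have hR' : (fun a b => R b a) = R := by
    funext a b; exact propext ⟨hs b a, hs a b⟩
  have hsim := isRefinedSimulation_of_renClosed hR h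
  exact ⟨R, ⟨hsim, hR'.symm ▸ hsim⟩, hpq⟩

theorem eval_renClosure (h : RefinedBisimilar p q) (he : Eval p p') :
    ∃ q', Eval q q' ∧ FreshNF (RenClosure RefinedBisimilar) p' q' := by
  obtain ⟨q', hq, hn⟩ := refinedBisimilar_isGreatest.1.1 _ _ _ h he
  exact ⟨q', hq, hn.toFreshNF⟩

theorem renClosed : RenClosed RefinedBisimilar := by
  intro a b ρ h
  refine of_symmetric (R := RenClosure RefinedBisimilar) RenClosure.renClosed ?_ ?_ (.rename ρ h)
  · rintro _ _ ⟨ρ, h⟩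
    exact .rename ρ h.symm
  · rintro _ _ p' ⟨ρ, h⟩ he
    obtain ⟨p', hp, rfl⟩ := he.reflect_rename
    obtain ⟨q', hq, hn⟩ := h.eval_renClosure hp
    exact ⟨_, hq.rename ρ, hn.rename RenClosure.renClosed ρ⟩

theorem eval (h : RefinedBisimilar p q) (he : Eval p p') :
    ∃ q', Eval q q' ∧ FreshNF RefinedBisimilar p' q' := by
  obtain ⟨q', hq, hn⟩ := h.eval_renClosure he
  refine ⟨q', hq, hn.mono ?_⟩
  rintro _ _ ⟨ρ, h⟩
  exact renClosed _ _ ρ h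

theorem refl (t : Tm) : RefinedBisimilar t t :=
  of_symmetric (R := Eq) (fun _ _ ρ => congrArg (Tm.rename ρ)) (fun _ _ => Eq.symm)
    (fun _ _ p' h he => ⟨p', h ▸ he, .refl (fun _ => rfl) he.2⟩) rfl

theorem trans (h₁ : RefinedBisimilar p q) (h₂ : RefinedBisimilar q r) :
    RefinedBisimilar p r := by
  refine of_symmetric (R := Relation.Comp RefinedBisimilar RefinedBisimilar)
    ?_ ?_ ?_ ⟨q, h₁, h₂⟩
  · rintro a c ρ ⟨b, h, h'⟩
    exact ⟨_, renClosed _ _ ρ h, renClosed _ _ ρ h'⟩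
  · rintro a c ⟨b, h, h'⟩
    exact ⟨b, h'.symm, h.symm⟩
  · rintro a c a' ⟨b, h, h'⟩ he
    obtain ⟨b', hb, hn⟩ := h.eval he
    obtain ⟨c', hc, hn'⟩ := h'.eval hb
    exact ⟨c', hc, hn.trans hn'⟩

theorem of_isNormal (hp : p.IsNormal) (hq : q.IsNormal) (h : FreshNF RefinedBisimilar p q) :
    RefinedBisimilar p q := by
  refine of_symmetric (R := fun a b => RefinedBisimilar a b ∨
    (a.IsNormal ∧ b.IsNormal ∧ FreshNF RefinedBisimilar a b)) ?_ ?_ ?_ (.inr ⟨hp, hq, h⟩)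
  · rintro a b ρ (h | ⟨ha, hb, h⟩)
    · exact .inl (renClosed _ _ _ h)
    · exact .inr ⟨ha.rename ρ, hb.rename ρ, h.rename renClosed ρ⟩
  · rintro a b (h | ⟨ha, hb, h⟩)
    · exact .inl h.symm
    · exact .inr ⟨hb, ha, h.flip.mono fun _ _ h => h.symm⟩
  · rintro a b a' (h | ⟨ha, hb, h⟩) he
    · obtain ⟨b', hb, hn⟩ := h.eval he
      exact ⟨b', hb, hn.mono fun _ _ => .inl⟩
    · obtain rfl := ha.eval.unique he
      exact ⟨b, hb.eval, h.mono fun _ _ => .inl⟩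

end RefinedBisimilar

/-! ### Administrative reductions -/

/-- Terms equal up to administrative redexes on the right-hand side. Capturing a context piece by
piece differs from capturing it at once by such redexes: `⟨E[t]⟩` corresponds to
`⟨(λx.⟨E[x]⟩) t⟩`, and `⟨t⟩` to `⟨⟨t⟩⟩`. -/
inductive Adm : Tm → Tm → Prop
  | var (n : ℕ) : Adm (.var n) (.var n)
  | lam {t s : Tm} : Adm t s → Adm (.lam t) (.lam s)
  | app {t s t' s' : Tm} : Adm t s → Adm t' s' → Adm (.app t t') (.app s s')
  | shift {t s : Tm} : Adm t s → Adm (.shift t) (.shift s)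
  | reset {t s : Tm} : Adm t s → Adm (.reset t) (.reset s)
  | delay {E : PureCtx} {e t s : Tm} : Adm E.body e → Adm t s → ¬ t.IsValue →
      Adm (.reset (E.plug t)) (.reset (.app (.lam (.reset e)) s))
  | double {t q : Tm} : Adm (.reset t) q → Adm (.reset t) (.reset q)
  | expand {p q q' : Tm} : Step 0 q q' → Adm p q' → Adm p q

theorem Tm.isValue_of_subst {t : Tm} {σ : ℕ → Val} (h : (t.subst σ).IsValue) : t.IsValue := by
  obtain ⟨v, hv⟩ := h
  cases t with
  | var n => exact ⟨.var n, rfl⟩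
  | lam t => exact ⟨.lam t, rfl⟩
  | _ => cases v <;> simp at hv

theorem EvalCtx.eq_comp_of_plug_eq {F : EvalCtx} {E : PureCtx} {x : ℕ} {v : Val} {t : Tm}
    (h : F.plug (.app (.var x) v.toTm) = E.plug t) (ht : ¬ t.IsValue) :
    ∃ G, F = E.toEval.comp G ∧ t = G.plug (.app (.var x) v.toTm) := by
  have hd : decomp (E.toEval.plug t) = .openStuck F x v := by
    rw [PureCtx.plug_toEval, ← h, decomp_plug_app_var]
  rcases t.isNormal_or_exists_step with hn | ⟨c, t', hs⟩
  · cases hn using Tm.IsNormal.induct with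
    | value w => exact absurd ⟨w, rfl⟩ ht
    | controlStuck G b =>
      rw [PureCtx.plug_toEval, ← PureCtx.plug_comp, decomp_plug_shift] at hd
      cases hd
    | openStuck G y w =>
      rw [← EvalCtx.plug_comp, decomp_plug_app_var] at hd
      cases hd
      exact ⟨G, rfl, rfl⟩
  · rw [step_iff_decomp.1 (hs.plug E.toEval)] at hd
    cases hd

namespace Adm

variable {p q p' q' t s t' s' e b : Tm} {v w v' : Val} {E E' : PureCtx} {F F' : EvalCtx}
  {c m n x : ℕ}

theorem refl (t : Tm) : Adm t t := by
  induction t with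
  | var n => exact .var n
  | lam t ih => exact .lam ih
  | app t s iht ihs => exact .app iht ihs
  | shift t ih => exact .shift ih
  | reset t ih => exact .reset ih

theorem of_steps (h : Steps 0 n q q') (hp : Adm p q') : Adm p q := by
  generalize hc : 0 = c at h
  induction h with
  | refl => exact hp
  | @head c s n _ _ _ h _ ih =>
    obtain ⟨rfl, rfl⟩ : c = 0 ∧ s = 0 := by omega
    exact .expand h (ih hp rfl)

theorem subst_of_forall_rename (h : Adm t s) {σ τ : ℕ → Val}
    (hσ : ∀ n ρ, Adm ((σ n).rename ρ).toTm ((τ n).rename ρ).toTm) :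
    Adm (t.subst σ) (s.subst τ) := by
  have up : ∀ {σ τ : ℕ → Val}, (∀ n ρ, Adm ((σ n).rename ρ).toTm ((τ n).rename ρ).toTm) →
      ∀ n ρ, Adm ((upSub σ n).rename ρ).toTm ((upSub τ n).rename ρ).toTm := by
    intro σ τ h n ρ
    cases n with
    | zero => exact .var _
    | succ n => simpa only [upSub_succ, Val.rename_rename] using h _ _
  induction h generalizing σ τ with
  | var n => simpa only [Val.toTm_rename, Tm.rename_id, Tm.subst] using hσ n id
  | lam _ ih => exact .lam (ih (up hσ))
  | app _ _ ih ih' => exact .app (ih hσ) (ih' hσ)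
  | shift _ ih => exact .shift (ih (up hσ))
  | reset _ ih => exact .reset (ih hσ)
  | delay _ _ hv ih ih' =>
    simp only [Tm.subst, PureCtx.subst_plug]
    refine .delay ?_ (ih' hσ) fun h => hv (Tm.isValue_of_subst h)
    rw [PureCtx.body_subst]
    exact ih (up hσ)
  | double _ ih => exact .double (ih hσ)
  | expand h _ ih => exact .expand (h.subst τ) (ih hσ)

theorem rename (h : Adm t s) (ρ : ℕ → ℕ) : Adm (t.rename ρ) (s.rename ρ) := by
  simp only [Tm.rename_eq_subst]
  exact h.subst_of_forall_rename fun _ _ => refl _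

theorem toTm_rename (h : Adm v.toTm w.toTm) (ρ : ℕ → ℕ) :
    Adm (v.rename ρ).toTm (w.rename ρ).toTm := by
  simpa only [Val.toTm_rename] using h.rename ρ

theorem inst (h : Adm t s) (hv : Adm v.toTm w.toTm) : Adm (t.inst v) (s.inst w) := by
  simp only [Tm.inst_eq_subst]
  refine h.subst_of_forall_rename fun n ρ => toTm_rename ?_ ρ
  cases n with
  | zero => exact hv
  | succ n => exact .var n

theorem body_rename (h : Adm E.body e) (ρ : ℕ → ℕ) :
    Adm (E.rename ρ).body (e.rename (upRen ρ)) := by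
  rw [PureCtx.body_rename]
  exact h.rename _

theorem body_appR (hv : Adm v.toTm v'.toTm) (h : Adm E.body E'.body) :
    Adm (PureCtx.appR v E).body (PureCtx.appR v' E').body :=
  .app (hv.toTm_rename _) h

theorem body_appL (ht : Adm t t') (h : Adm E.body E'.body) :
    Adm (PureCtx.appL E t).body (PureCtx.appL E' t').body :=
  .app h (ht.rename _)

/-! ### Inversion of administrative reductions -/

theorem var_inv (h : Adm (.var x) q) : ∃ n, Steps 0 n q (.var x) := by
  generalize hp : Tm.var x = p at h
  induction h with
  | var n => exact ⟨0, hp ▸ .refl _⟩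
  | expand h _ ih => obtain ⟨n, hn⟩ := ih hp; exact ⟨_, .head h hn⟩
  | _ => cases hp

theorem lam_inv (h : Adm (.lam t) q) : ∃ t' n, Steps 0 n q (.lam t') ∧ Adm t t' := by
  generalize hp : Tm.lam t = p at h
  induction h with
  | lam h _ => cases hp; exact ⟨_, 0, .refl _, h⟩
  | expand h _ ih => obtain ⟨t', n, hn, ht⟩ := ih hp; exact ⟨_, _, .head h hn, ht⟩
  | _ => cases hp

theorem toTm_inv (h : Adm v.toTm q) :
    ∃ v' n, Steps 0 n q (Val.toTm v') ∧ Adm v.toTm v'.toTm ∧ Adm v.body v'.body := by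
  cases v with
  | var x => obtain ⟨n, hn⟩ := var_inv h; exact ⟨.var x, n, hn, .var x, refl _⟩
  | lam t => obtain ⟨t', n, hn, ht⟩ := lam_inv h; exact ⟨.lam t', n, hn, .lam ht, ht⟩

theorem delay_of_body (hE : Adm E.body e) (ht : Adm t s) :
    Adm (.reset (E.plug t)) (.reset (.app (.lam (.reset e)) s)) := by
  by_cases hv : t.IsValue
  · obtain ⟨v, rfl⟩ := hv
    obtain ⟨v', n, hs, hv, -⟩ := toTm_inv ht
    have hs' := hs.plug (.reset (.appR (.lam (.reset e)) .hole))
    have hbeta : Step 0 _ _ := .beta (.reset .hole) (.reset e) v'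
    refine of_steps (hs'.trans (.single hbeta)) (.double (.reset ?_))
    rw [← PureCtx.body_inst]
    exact hE.inst hv
  · exact .delay hE ht hv

theorem controlStuck_inv (h : Adm (E.plug (.shift b)) q) :
    ∃ E' b' n, Steps 0 n q (PureCtx.plug E' (.shift b')) ∧ Adm E.body E'.body ∧ Adm b b' := by
  generalize hp : E.plug (.shift b) = p at h
  induction h generalizing E with
  | shift h _ =>
    cases E <;> cases hp
    exact ⟨.hole, _, 0, .refl _, refl _, h⟩
  | @app t s t' s' h h' ih ih' =>
    cases E with
    | hole => cases hp
    | appR v E =>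
      cases hp
      obtain ⟨v', n, hs, hv, -⟩ := toTm_inv h
      obtain ⟨E', b', m, hs', hE, hb⟩ := ih' rfl
      exact ⟨.appR v' E', b', _, (hs.plug (.appL .hole s')).trans (hs'.plug (.appR v' .hole)),
        body_appR hv hE, hb⟩
    | appL E t =>
      cases hp
      obtain ⟨E', b', m, hs', hE, hb⟩ := ih rfl
      exact ⟨.appL E' s', b', _, hs'.plug (.appL .hole s'), body_appL h' hE, hb⟩
  | expand h _ ih =>
    obtain ⟨E', b', n, hn, ht⟩ := ih hp
    exact ⟨_, _, _, .head h hn, ht⟩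
  | _ => cases E <;> cases hp

theorem freshCtxRel_appR (hv : Adm v.toTm v'.toTm) (h : FreshCtxRel Adm F F') :
    FreshCtxRel Adm (.appR v F) (.appR v' F') := by
  cases h with
  | pure h => exact .pure (body_appR hv h)
  | @delimited F F' _ _ hF hE =>
    exact .delimited (F₀ := .appR v F) (F₁ := .appR v' F') (.app (hv.toTm_rename _) hF) hE

theorem freshCtxRel_appL (ht : Adm t t') (h : FreshCtxRel Adm F F') :
    FreshCtxRel Adm (.appL F t) (.appL F' t') := by
  cases h with
  | pure h => exact .pure (body_appL ht h)
  | @delimited F F' _ _ hF hE =>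
    exact .delimited (F₀ := .appL F t) (F₁ := .appL F' t') (.app hF (ht.rename _)) hE

theorem freshCtxRel_reset (h : FreshCtxRel Adm F F') :
    FreshCtxRel Adm (.reset F) (.reset F') := by
  cases h with
  | pure h => exact .delimited (F₀ := .hole) (F₁ := .hole) (.var 0) (.reset h)
  | @delimited F F' _ _ hF hE =>
    exact .delimited (F₀ := .reset F) (F₁ := .reset F') (.reset hF) hE

theorem freshCtxRel_delay (hE : Adm E.body e) (h : FreshCtxRel Adm F F') :
    FreshCtxRel Adm (.reset (E.toEval.comp F)) (.reset (.appR (.lam (.reset e)) F')) := by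
  have hE' := hE.body_rename Nat.succ
  cases h with
  | @pure E₀ E₁ h =>
    have hbody : Adm (.reset (E.comp E₀).body)
        (.reset (PureCtx.appR (.lam (.reset e)) E₁).body) := by
      rw [PureCtx.body_comp]
      exact delay_of_body hE' h
    rw [← PureCtx.toEval_comp]
    exact .delimited (F₀ := .hole) (F₁ := .hole) (.var 0) hbody
  | @delimited G₀ G₁ _ _ hG hE₀ =>
    rw [← EvalCtx.comp_assoc]
    refine .delimited (F₀ := .reset (E.toEval.comp G₀))
      (F₁ := .reset (.appR (.lam (.reset e)) G₁)) ?_ hE₀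
    change Adm (.reset (E.toEval.comp G₀).body) _
    rw [EvalCtx.body_comp, EvalCtx.rename_eq_subst, ← PureCtx.toEval_subst,
      ← PureCtx.rename_eq_subst, PureCtx.plug_toEval]
    exact delay_of_body hE' hG

theorem freshCtxRel_double (h : FreshCtxRel Adm (.reset F) F') :
    FreshCtxRel Adm (.reset F) (.reset F') := by
  generalize hF : EvalCtx.reset F = G at h
  cases h with
  | @pure E _ _ => cases E <;> cases hF
  | @delimited G₀ G₁ _ _ hG hE =>
    refine .delimited (F₁ := .reset G₁) ?_ hE
    cases G₀ with
    | hole =>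
      obtain ⟨n, hn⟩ := var_inv hG
      exact of_steps ((hn.plug (.reset .hole)).trans (.single (.reset .hole (.var 0)))) (.var 0)
    | reset G => exact .double hG
    | _ => cases hF

/-- The term `q` reduces administratively to an open stuck term related to `F[x v]`. -/
def ReachesOpenStuck (F : EvalCtx) (x : ℕ) (v : Val) (q : Tm) : Prop :=
  ∃ F' v' n, Steps 0 n q (EvalCtx.plug F' (.app (.var x) (Val.toTm v'))) ∧
    FreshCtxRel Adm F F' ∧ Adm v.body v'.body

namespace ReachesOpenStuck

theorem of_plug (G : EvalCtx) (h : ReachesOpenStuck F x v q)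
    (hF : ∀ H, FreshCtxRel Adm F H → FreshCtxRel Adm F' (G.comp H)) :
    ReachesOpenStuck F' x v (G.plug q) := by
  obtain ⟨H, v', n, hs, hH, hv⟩ := h
  refine ⟨G.comp H, v', n, ?_, hF H hH, hv⟩
  rw [EvalCtx.plug_comp]
  exact hs.plug G

theorem of_steps (hs : Steps 0 n q q') (h : ReachesOpenStuck F x v q') :
    ReachesOpenStuck F x v q := by
  obtain ⟨H, v', m, hs', h⟩ := h
  exact ⟨H, v', _, hs.trans hs', h⟩

theorem of_app (h : Adm t s) (h' : Adm t' s')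
    (ih : ∀ {F}, F.plug (.app (.var x) v.toTm) = t → ReachesOpenStuck F x v s)
    (ih' : ∀ {F}, F.plug (.app (.var x) v.toTm) = t' → ReachesOpenStuck F x v s')
    (hF : F.plug (.app (.var x) v.toTm) = .app t t') :
    ReachesOpenStuck F x v (.app s s') := by
  cases F with
  | hole =>
    cases hF
    obtain ⟨n, hs⟩ := var_inv h
    obtain ⟨v', m, hs', -, hv⟩ := toTm_inv h'
    exact ⟨.hole, v', _, (hs.plug (.appL .hole s')).trans (hs'.plug (.appR (.var x) .hole)),
      .pure (E₀ := .hole) (E₁ := .hole) (.var 0), hv⟩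
  | appR w F =>
    cases hF
    obtain ⟨w', n, hs, hw, -⟩ := toTm_inv h
    exact of_steps (hs.plug (.appL .hole s'))
      ((ih' rfl).of_plug (.appR w' .hole) fun _ => freshCtxRel_appR hw)
  | appL F t =>
    cases hF
    exact (ih rfl).of_plug (.appL .hole s') fun _ => freshCtxRel_appL h'
  | reset F => cases hF

end ReachesOpenStuck

theorem openStuck_inv (h : Adm (F.plug (.app (.var x) v.toTm)) q) :
    ReachesOpenStuck F x v q := by
  generalize hp : F.plug (.app (.var x) v.toTm) = p at h
  induction h generalizing F with
  | app h h' ih ih' => exact .of_app h h' ih ih' hp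
  | reset _ ih =>
    cases F <;> cases hp
    exact (ih rfl).of_plug (.reset .hole) fun _ => freshCtxRel_reset
  | @delay E e _ _ hE _ ht _ ih =>
    cases F <;> simp only [EvalCtx.plug, reduceCtorEq, Tm.reset.injEq] at hp
    obtain ⟨G, rfl, hG⟩ := EvalCtx.eq_comp_of_plug_eq hp ht
    exact (ih hG.symm).of_plug (.reset (.appR (.lam (.reset e)) .hole)) fun _ =>
      freshCtxRel_delay hE
  | double _ ih =>
    have hq := ih hp
    cases F <;> cases hp
    exact hq.of_plug (.reset .hole) fun _ => freshCtxRel_double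
  | expand h _ ih => exact .of_steps (.single h) (ih hp)
  | _ => cases F <;> cases hp

theorem isNormal_inv (h : Adm p q) (hp : p.IsNormal) :
    ∃ q' n, Steps 0 n q q' ∧ q'.IsNormal ∧ FreshNF Adm p q' := by
  cases hp using Tm.IsNormal.induct with
  | value v =>
    obtain ⟨v', n, hs, -, hv⟩ := toTm_inv h
    exact ⟨_, n, hs, isNormal_toTm _, .value hv⟩
  | controlStuck E b =>
    obtain ⟨E', b', n, hs, hE, hb⟩ := controlStuck_inv h
    refine ⟨_, n, hs, isNormal_plug_shift _ _, .controlStuck (.reset ?_)⟩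
    refine (hb.rename _).inst (.lam (.reset (body_appR (.var 0) ?_)))
    simpa only [PureCtx.body_rename] using hE.body_rename Nat.succ
  | openStuck F x v =>
    obtain ⟨F', v', n, hs, hF, hv⟩ := openStuck_inv h
    exact ⟨_, n, hs, isNormal_plug_app_var _ _ _, .openStuck hF hv⟩

/-! ### Administrative reductions are bisimilarities -/

/-- Every step of `t` is matched by at least one step of `s`, with the same number of captures. -/
def Simulates (t s : Tm) : Prop :=
  ∀ c t', Step c t t' → ∃ s' n, Steps c (n + 1) s s' ∧ Adm t' s'

namespace Simulates

theorem app (h : Adm t s) (h' : Adm t' s') (ih : Simulates t s) (ih' : Simulates t' s') :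
    Simulates (.app t t') (.app s s') := by
  intro c r hp
  rcases hp.app_inv with ⟨r, hr, rfl⟩ | ⟨v, r, rfl, hr, rfl⟩ | ⟨b, v, rfl, rfl, rfl, rfl⟩
  · obtain ⟨q, n, hq, ha⟩ := ih _ _ hr
    exact ⟨_, _, hq.plug (.appL .hole s'), .app ha h'⟩
  · obtain ⟨v', m, hs, hv, -⟩ := toTm_inv h
    obtain ⟨q, n, hq, ha⟩ := ih' _ _ hr
    have hsteps := (hs.plug (.appL .hole s')).trans (hq.plug (.appR v' .hole))
    rw [zero_add, ← add_assoc] at hsteps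
    exact ⟨_, _, hsteps, .app hv ha⟩
  · obtain ⟨b', m, hs, hb⟩ := lam_inv h
    obtain ⟨v', m', hs', hv, -⟩ := toTm_inv h'
    exact ⟨_, _, ((hs.plug (.appL .hole s')).trans (hs'.plug (.appR (.lam b') .hole))).trans
      (.single (.beta .hole b' v')), hb.inst hv⟩

theorem reset (h : Adm t s) (ih : Simulates t s) : Simulates (.reset t) (.reset s) := by
  intro c r hp
  rcases hp.reset_inv with ⟨r, hr, rfl⟩ | ⟨E, b, rfl, rfl, rfl⟩ | ⟨v, rfl, rfl, rfl⟩
  · obtain ⟨q, n, hq, ha⟩ := ih _ _ hr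
    exact ⟨_, _, hq.plug (.reset .hole), .reset ha⟩
  · obtain ⟨E', b', m, hs, hE, hb⟩ := controlStuck_inv h
    exact ⟨_, _, (hs.plug (.reset .hole)).trans (.single (.capture .hole E' b')),
      .reset (hb.inst (.lam (.reset hE)))⟩
  · obtain ⟨v', m, hs, hv, -⟩ := toTm_inv h
    exact ⟨_, _, (hs.plug (.reset .hole)).trans (.single (.reset .hole v')), hv⟩

theorem delay_controlStuck (hE : Adm E.body e) {G : PureCtx}
    (h : Adm (G.plug (.shift b)) s) :
    Simulates (.reset (E.plug (G.plug (.shift b)))) (.reset (.app (.lam (.reset e)) s)) := by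
  intro c r hp
  obtain ⟨G', b', m, hs, hG, hb⟩ := controlStuck_inv h
  have hcapture := Step.capture .hole (E.comp G) b
  rw [PureCtx.plug_comp] at hcapture
  obtain ⟨rfl, rfl⟩ := hp.det hcapture
  refine ⟨_, _, (hs.plug (.reset (.appR (.lam (.reset e)) .hole))).trans
    (.single (.capture .hole (.appR (.lam (.reset e)) G') b')), .reset (hb.inst (.lam ?_))⟩
  change Adm (.reset (E.comp G).body) _
  rw [PureCtx.body_comp]
  exact delay_of_body (hE.body_rename Nat.succ) hG

theorem delay (hE : Adm E.body e) (h : Adm t s) (hv : ¬ t.IsValue) (ih : Simulates t s) :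
    Simulates (.reset (E.plug t)) (.reset (.app (.lam (.reset e)) s)) := by
  rcases t.isNormal_or_exists_step with ht | ⟨d, t', ht⟩
  · cases ht using Tm.IsNormal.induct with
    | value v => exact absurd ⟨v, rfl⟩ hv
    | controlStuck G b => exact delay_controlStuck hE h
    | openStuck F x v =>
      have hn := isNormal_plug_app_var ((EvalCtx.reset E.toEval).comp F) x v
      rw [EvalCtx.plug_comp, EvalCtx.plug, PureCtx.plug_toEval] at hn
      exact fun _ _ hp => absurd hp hn.not_step
  · intro c r hp
    have hp' := ht.plug (.reset E.toEval)
    simp only [EvalCtx.plug, PureCtx.plug_toEval] at hp'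
    obtain ⟨rfl, rfl⟩ := hp.det hp'
    obtain ⟨q, n, hq, ha⟩ := ih _ _ ht
    exact ⟨_, _, hq.plug (.reset (.appR (.lam (.reset e)) .hole)), delay_of_body hE ha⟩

theorem double (ih : Simulates (.reset t) q) : Simulates (.reset t) (.reset q) := by
  intro c r hp
  obtain ⟨q', n, hq, ha⟩ := ih _ _ hp
  have hq' := hq.plug (.reset .hole)
  rcases hp.reset_inv with ⟨r, -, rfl⟩ | ⟨E, b, rfl, rfl, rfl⟩ | ⟨v, rfl, rfl, rfl⟩
  · exact ⟨_, _, hq', .double ha⟩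
  · exact ⟨_, _, hq', .double ha⟩
  · obtain ⟨v', m, hs, hv, -⟩ := toTm_inv ha
    exact ⟨_, _, (hq'.trans (hs.plug (.reset .hole))).trans (.single (.reset .hole v')), hv⟩

end Simulates

theorem simulates (h : Adm p q) : Simulates p q := by
  induction h with
  | var n => exact fun _ _ hp => absurd hp (isNormal_toTm (.var n)).not_step
  | @lam t => exact fun _ _ hp => absurd hp (isNormal_toTm (.lam t)).not_step
  | @shift t => exact fun _ _ hp => absurd hp (isNormal_plug_shift .hole t).not_step
  | app h h' ih ih' => exact .app h h' ih ih'
  | reset h ih => exact .reset h ih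
  | delay hE h hv _ ih => exact .delay hE h hv ih
  | double _ ih => exact .double ih
  | expand h _ ih =>
    intro c r hp
    obtain ⟨q', n, hq, ha⟩ := ih _ _ hp
    have hsteps := Steps.head h hq
    rw [zero_add] at hsteps
    exact ⟨q', _, hsteps, ha⟩

theorem steps (h : Adm p q) {s : ℕ} (hp : Steps s n p p') :
    ∃ q' m, Steps s m q q' ∧ Adm p' q' := by
  induction hp generalizing q with
  | refl t => exact ⟨q, 0, .refl _, h⟩
  | head hs _ ih =>
    obtain ⟨q₁, m, hq, h⟩ := h.simulates _ _ hs
    obtain ⟨q₂, m', hq', h⟩ := ih h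
    exact ⟨q₂, _, hq.trans hq', h⟩

theorem steps_isNormal (h : Adm p q) {s : ℕ} (hp : Steps s n p p') (hn : p'.IsNormal) :
    ∃ q' m, Steps s m q q' ∧ q'.IsNormal ∧ FreshNF Adm p' q' := by
  obtain ⟨q₁, m, hq, h⟩ := h.steps hp
  obtain ⟨q', k, hq', hn', h⟩ := h.isNormal_inv hn
  exact ⟨q', _, hq.trans hq', hn', h⟩

theorem eval (h : Adm p q) (hp : Eval p p') : ∃ q', Eval q q' ∧ FreshNF Adm p' q' := by
  obtain ⟨⟨s, n, hs⟩, hn⟩ := eval_iff.1 hp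
  obtain ⟨q', m, hq, hn', hN⟩ := h.steps_isNormal hs hn
  exact ⟨q', eval_iff.2 ⟨⟨_, _, hq⟩, hn'⟩, hN⟩

theorem exists_eval_of_steps (h : Adm p q) {s : ℕ} (hq : Steps s n q q') (hn : q'.IsNormal) :
    ∃ p', Eval p p' := by
  induction n using Nat.strong_induction_on generalizing p q s with
  | _ n ih =>
    rcases p.isNormal_or_exists_step with hp | ⟨c, p₁, hp⟩
    · exact ⟨p, hp.eval⟩
    · obtain ⟨q₁, m, hq₁, h⟩ := h.simulates _ _ hp
      obtain ⟨s', n', hs, -, hn'⟩ := hq₁.cancel hq hn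
      obtain ⟨p', he⟩ := ih n' (by omega) h hs
      exact ⟨p', (Steps.single hp).eval he⟩

theorem refinedBisimilar (h : Adm p q) : RefinedBisimilar p q := by
  refine ⟨Adm, ⟨isRefinedSimulation_of_renClosed (fun _ _ ρ h => h.rename ρ) fun p q p' h he =>
    h.eval he, isRefinedSimulation_of_renClosed (fun _ _ ρ h => h.rename ρ) ?_⟩, h⟩
  intro q p q' h he
  obtain ⟨⟨s, n, hs⟩, hn⟩ := eval_iff.1 he
  obtain ⟨p', hp⟩ := h.exists_eval_of_steps hs hn
  obtain ⟨q'', hq, hN⟩ := h.eval hp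
  obtain rfl := hq.unique he
  exact ⟨p', hp, hN.flip⟩

end Adm

/-! ### Related values, continuations and stacks -/

mutual

/-- Values generated from bisimilar values by nested substitutions and by the reification of
related continuations. -/
inductive RelatedVal : Val → Val → Prop
  | var (n : ℕ) : RelatedVal (.var n) (.var n)
  | closure {v₀ v₁ : Val} {σ₀ σ₁ : ℕ → Val} : RefinedBisimilar v₀.body v₁.body →
      (∀ n, RelatedVal (σ₀ n) (σ₁ n)) → RelatedVal (v₀.subst σ₀) (v₁.subst σ₁)
  | reify {E₀ E₁ : PureCtx} : RelatedCont E₀ E₁ → RelatedVal E₀.reify E₁.reify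

/-- Continuations, that is, pure contexts considered under a reset, generated from closures of
bisimilar contexts. -/
inductive RelatedCont : PureCtx → PureCtx → Prop
  | base {E₀ E₁ : PureCtx} {σ₀ σ₁ : ℕ → Val} :
      RefinedBisimilar (.reset E₀.body) (.reset E₁.body) →
      (∀ n, RelatedVal (σ₀ n) (σ₁ n)) → RelatedCont (E₀.subst σ₀) (E₁.subst σ₁)
  | push {E₀ E₁ G₀ G₁ : PureCtx} {σ₀ σ₁ : ℕ → Val} : RelatedCont E₀ E₁ →
      RefinedBisimilar G₀.body G₁.body → (∀ n, RelatedVal (σ₀ n) (σ₁ n)) →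
      RelatedCont (E₀.comp (G₀.subst σ₀)) (E₁.comp (G₁.subst σ₁))

end

/-- Substitutions that are pointwise related. -/
abbrev RelatedEnv (σ₀ σ₁ : ℕ → Val) : Prop := ∀ n, RelatedVal (σ₀ n) (σ₁ n)

/-- A sufficient condition, stable under reduction, for a term never to become control stuck. -/
def Safe (t : Tm) : Prop := t.IsValue ∨ ∃ s, t = .reset s

/-- Stacks of `k` related frames. The flag tells whether arbitrary terms may be plugged (`true`) or
only safe ones (`false`): a frame of type `eval` relates evaluation contexts only through their
action on values, hence it cannot be captured. -/
inductive RelatedStack : (k : ℕ) → (b : Bool) → EvalCtx → EvalCtx → Prop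
  | nil : RelatedStack 0 true .hole .hole
  | pure {k : ℕ} {F₀ F₁ : EvalCtx} {E₀ E₁ : PureCtx} {σ₀ σ₁ : ℕ → Val} :
      RelatedStack k true F₀ F₁ → RefinedBisimilar E₀.body E₁.body → RelatedEnv σ₀ σ₁ →
      RelatedStack (k + 1) true (F₀.comp (E₀.subst σ₀).toEval) (F₁.comp (E₁.subst σ₁).toEval)
  | eval {k : ℕ} {b : Bool} {F₀ F₁ G₀ G₁ : EvalCtx} {σ₀ σ₁ : ℕ → Val} :
      RelatedStack k b F₀ F₁ → RefinedBisimilar G₀.body G₁.body →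
      (b = false → Safe G₀.body ∧ Safe G₁.body) → RelatedEnv σ₀ σ₁ →
      RelatedStack (k + 1) false (F₀.comp (G₀.subst σ₀)) (F₁.comp (G₁.subst σ₁))
  | delimited {k : ℕ} {F₀ F₁ : EvalCtx} {E₀ E₁ : PureCtx} {σ₀ σ₁ : ℕ → Val} :
      RelatedStack k false F₀ F₁ → RefinedBisimilar (.reset E₀.body) (.reset E₁.body) →
      RelatedEnv σ₀ σ₁ →
      RelatedStack (k + 1) true (F₀.comp (.reset (E₀.subst σ₀).toEval))
        (F₁.comp (.reset (E₁.subst σ₁).toEval))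

/-- Related configurations: closures of bisimilar terms in related stacks of `k` frames. -/
inductive RelatedConf : (k : ℕ) → Tm → Tm → Prop
  | intro {k : ℕ} {b : Bool} {F₀ F₁ : EvalCtx} {t₀ t₁ : Tm} {σ₀ σ₁ : ℕ → Val} :
      RelatedStack k b F₀ F₁ → RefinedBisimilar t₀ t₁ → (b = false → Safe t₀ ∧ Safe t₁) →
      RelatedEnv σ₀ σ₁ → RelatedConf k (F₀.plug (t₀.subst σ₀)) (F₁.plug (t₁.subst σ₁))

/-- Related configurations up to bisimilarity on both sides. -/
def RelatedConfUpTo (p q : Tm) : Prop :=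
  ∃ k a b, RefinedBisimilar p a ∧ RelatedConf k a b ∧ RefinedBisimilar b q

section Renaming

variable (E G : PureCtx) (F H : EvalCtx) (σ : ℕ → Val) (ρ : ℕ → ℕ)

theorem PureCtx.rename_subst : (E.subst σ).rename ρ = E.subst fun n => (σ n).rename ρ := by
  simp only [PureCtx.rename_eq_subst, PureCtx.subst_subst, Val.rename_eq_subst]

theorem EvalCtx.rename_subst : (F.subst σ).rename ρ = F.subst fun n => (σ n).rename ρ := by
  simp only [EvalCtx.rename_eq_subst, EvalCtx.subst_subst, Val.rename_eq_subst]

theorem PureCtx.rename_comp : (E.comp G).rename ρ = (E.rename ρ).comp (G.rename ρ) := by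
  simp only [PureCtx.rename_eq_subst, PureCtx.subst_comp]

theorem EvalCtx.rename_comp : (F.comp H).rename ρ = (F.rename ρ).comp (H.rename ρ) := by
  simp only [EvalCtx.rename_eq_subst, EvalCtx.subst_comp]

theorem PureCtx.toEval_rename : (E.rename ρ).toEval = E.toEval.rename ρ := by
  simp only [EvalCtx.rename_eq_subst, PureCtx.rename_eq_subst, PureCtx.toEval_subst]

theorem PureCtx.reify_rename : E.reify.rename ρ = (E.rename ρ).reify := by
  simp only [Val.rename_eq_subst, PureCtx.rename_eq_subst, PureCtx.reify_subst]

end Renaming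

mutual

theorem RelatedVal.rename {v₀ v₁ : Val} (ρ : ℕ → ℕ) :
    RelatedVal v₀ v₁ → RelatedVal (v₀.rename ρ) (v₁.rename ρ)
  | .var _ => .var _
  | .closure h hσ => by
    rw [Val.rename_subst, Val.rename_subst]
    exact .closure h fun n => (hσ n).rename ρ
  | .reify h => by
    rw [PureCtx.reify_rename, PureCtx.reify_rename]
    exact .reify (h.rename ρ)

theorem RelatedCont.rename {E₀ E₁ : PureCtx} (ρ : ℕ → ℕ) :
    RelatedCont E₀ E₁ → RelatedCont (E₀.rename ρ) (E₁.rename ρ)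
  | .base h hσ => by
    rw [PureCtx.rename_subst, PureCtx.rename_subst]
    exact .base h fun n => (hσ n).rename ρ
  | .push hE h hσ => by
    rw [PureCtx.rename_comp, PureCtx.rename_comp, PureCtx.rename_subst, PureCtx.rename_subst]
    exact .push (hE.rename ρ) h fun n => (hσ n).rename ρ

end

mutual

theorem RelatedVal.symm {v₀ v₁ : Val} : RelatedVal v₀ v₁ → RelatedVal v₁ v₀
  | .var _ => .var _
  | .closure h hσ => .closure h.symm fun n => (hσ n).symm
  | .reify h => .reify h.symm

theorem RelatedCont.symm {E₀ E₁ : PureCtx} : RelatedCont E₀ E₁ → RelatedCont E₁ E₀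
  | .base h hσ => .base h.symm fun n => (hσ n).symm
  | .push hE h hσ => .push hE.symm h.symm fun n => (hσ n).symm

end

namespace RelatedEnv

variable {σ₀ σ₁ : ℕ → Val}

theorem var : RelatedEnv Val.var Val.var := fun n => .var n

theorem scons {v₀ v₁ : Val} (hv : RelatedVal v₀ v₁) (hσ : RelatedEnv σ₀ σ₁) :
    RelatedEnv (scons v₀ σ₀) (scons v₁ σ₁)
  | 0 => hv
  | n + 1 => hσ n

theorem rename (hσ : RelatedEnv σ₀ σ₁) (ρ : ℕ → ℕ) :
    RelatedEnv (fun n => (σ₀ n).rename ρ) (fun n => (σ₁ n).rename ρ) :=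
  fun n => (hσ n).rename ρ

theorem symm (hσ : RelatedEnv σ₀ σ₁) : RelatedEnv σ₁ σ₀ := fun n => (hσ n).symm

end RelatedEnv

namespace Safe

variable {t t' : Tm}

theorem toTm (v : Val) : Safe v.toTm := .inl ⟨v, rfl⟩

theorem reset (t : Tm) : Safe (.reset t) := .inr ⟨t, rfl⟩

theorem step {c : ℕ} (h : Safe t) (hs : Step c t t') : Safe t' := by
  rcases h with ⟨v, rfl⟩ | ⟨s, rfl⟩
  · exact absurd hs (isNormal_toTm v).not_step
  · rcases hs.reset_inv with ⟨r, _, rfl⟩ | ⟨E, b, rfl, rfl, rfl⟩ | ⟨v, rfl, rfl, rfl⟩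
    exacts [.reset _, .reset _, .toTm v]

theorem steps {s n : ℕ} (h : Safe t) (hs : Steps s n t t') : Safe t' := by
  induction hs with
  | refl => exact h
  | head hs _ ih => exact ih (h.step hs)

theorem not_app (t s : Tm) : ¬ Safe (.app t s) := by
  rintro (⟨v, h⟩ | ⟨r, h⟩)
  · cases v <;> cases h
  · cases h

theorem not_plug_shift (E : PureCtx) (t : Tm) : ¬ Safe (E.plug (.shift t)) := by
  rintro (⟨v, h⟩ | ⟨r, h⟩)
  · cases E <;> cases v <;> cases h
  · cases E <;> cases h

theorem body_of_plug {G F : EvalCtx} (h : Safe ((G.comp (.reset F)).plug t)) : Safe G.body := by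
  cases G with
  | hole => exact .toTm (.var 0)
  | appR v G => exact absurd h (not_app _ _)
  | appL G t => exact absurd h (not_app _ _)
  | reset G => exact .reset _

end Safe

namespace RelatedStack

variable {k : ℕ} {b : Bool} {F₀ F₁ G₀ G₁ : EvalCtx} {u₀ u₁ : Val} {σ₀ σ₁ : ℕ → Val}

theorem rename (h : RelatedStack k b F₀ F₁) (ρ : ℕ → ℕ) :
    RelatedStack k b (F₀.rename ρ) (F₁.rename ρ) := by
  induction h with
  | nil => exact .nil
  | pure _ h hσ ih =>
    simp only [EvalCtx.rename_comp, ← PureCtx.toEval_rename, PureCtx.rename_subst]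
    exact .pure ih h (hσ.rename ρ)
  | eval _ h hs hσ ih =>
    simp only [EvalCtx.rename_comp, EvalCtx.rename_subst]
    exact .eval ih h hs (hσ.rename ρ)
  | delimited _ h hσ ih =>
    simp only [EvalCtx.rename_comp, EvalCtx.rename, ← PureCtx.toEval_rename,
      PureCtx.rename_subst]
    exact .delimited ih h (hσ.rename ρ)

theorem symm (h : RelatedStack k b F₀ F₁) : RelatedStack k b F₁ F₀ := by
  induction h with
  | nil => exact .nil
  | pure _ h hσ ih => exact .pure ih h.symm hσ.symm
  | eval _ h hs hσ ih => exact .eval ih h.symm (fun hb => (hs hb).symm) hσ.symm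
  | delimited _ h hσ ih => exact .delimited ih h.symm hσ.symm

theorem to_false (h : RelatedStack k true F₀ F₁) : RelatedStack (k + 1) false F₀ F₁ := by
  have := RelatedStack.eval (G₀ := .hole) (G₁ := .hole) h (.refl _) (by simp) .var
  simpa only [EvalCtx.subst_var, EvalCtx.comp_hole] using this

theorem plug_toTm (h : RelatedStack k b F₀ F₁) (hu : RelatedVal u₀ u₁) :
    RelatedConf k (F₀.plug u₀.toTm) (F₁.plug u₁.toTm) :=
  .intro (t₀ := .var 0) h (.refl _) (fun _ => ⟨.toTm (.var 0), .toTm (.var 0)⟩)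
    (.scons hu .var)

theorem eq_hole_or_pop (h : RelatedStack k b F₀ F₁) (hu : RelatedVal u₀ u₁) :
    (F₀ = .hole ∧ F₁ = .hole) ∨
      ∃ k' < k, RelatedConf k' (F₀.plug u₀.toTm) (F₁.plug u₁.toTm) := by
  cases h with
  | nil => exact .inl ⟨rfl, rfl⟩
  | pure hF h hσ =>
    have hC := RelatedConf.intro hF h (by simp) (.scons hu hσ)
    simp only [PureCtx.body_subst_scons, ← PureCtx.plug_toEval, ← EvalCtx.plug_comp] at hC
    exact .inr ⟨_, Nat.lt_succ_self _, hC⟩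
  | eval hF h hs hσ =>
    have hC := RelatedConf.intro hF h hs (.scons hu hσ)
    simp only [EvalCtx.body_subst_scons, ← EvalCtx.plug_comp] at hC
    exact .inr ⟨_, Nat.lt_succ_self _, hC⟩
  | delimited hF h hσ =>
    have hC := RelatedConf.intro hF h (fun _ => ⟨.reset _, .reset _⟩) (.scons hu hσ)
    simp only [Tm.subst, PureCtx.body_subst_scons] at hC
    refine .inr ⟨_, Nat.lt_succ_self _, ?_⟩
    simpa only [EvalCtx.plug_comp, EvalCtx.plug, PureCtx.plug_toEval] using hC

theorem exists_push (h : RelatedStack k b F₀ F₁) (hG : FreshCtxRel RefinedBisimilar G₀ G₁)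
    {t₀ t₁ s₀ s₁ : Tm}
    (hs : b = false → Safe (G₀.plug (.app t₀ s₀)) ∧ Safe (G₁.plug (.app t₁ s₁)))
    (hσ : RelatedEnv σ₀ σ₁) :
    ∃ k', RelatedStack k' true (F₀.comp (G₀.subst σ₀)) (F₁.comp (G₁.subst σ₁)) := by
  cases hG with
  | @pure E₀ E₁ hE =>
    simp only [← PureCtx.toEval_subst]
    cases b with
    | true => exact ⟨_, .pure h hE hσ⟩
    | false => cases E₀ <;> exact absurd (hs rfl).1 (Safe.not_app _ _)
  | delimited hG hE =>
    simp only [EvalCtx.subst_comp, EvalCtx.subst, ← PureCtx.toEval_subst, ← EvalCtx.comp_assoc]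
    exact ⟨_, .delimited
      (.eval h hG (fun hb => ⟨(hs hb).1.body_of_plug, (hs hb).2.body_of_plug⟩) hσ) hE hσ⟩

theorem exists_delimited (hF : RelatedStack k false F₀ F₁) : ∀ {E₀ E₁}, RelatedCont E₀ E₁ →
    ∃ k', RelatedStack k' true (F₀.comp (.reset E₀.toEval)) (F₁.comp (.reset E₁.toEval))
  | _, _, .base h hσ => ⟨_, .delimited hF h hσ⟩
  | _, _, .push hE h hσ => by
    obtain ⟨k', hk⟩ := exists_delimited hF hE
    have := hk.pure h hσ
    simp only [EvalCtx.comp_assoc, EvalCtx.comp, ← PureCtx.toEval_comp] at this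
    exact ⟨_, this⟩

/-- In the first case, the continuation captured by a control operator is `k' E` for the variable
`k'` introduced by the normal form test of control stuck terms. -/
theorem pure_or_delimited (h : RelatedStack k true F₀ F₁) :
    (∃ E₀ E₁, F₀ = PureCtx.toEval E₀ ∧ F₁ = PureCtx.toEval E₁ ∧
      ∀ k' ρ, RelatedCont (.appR (.var k') (E₀.rename ρ)) (.appR (.var k') (E₁.rename ρ))) ∨
    ∃ k' G₀ G₁ E₀ E₁, F₀ = EvalCtx.comp G₀ (.reset (PureCtx.toEval E₀)) ∧
      F₁ = EvalCtx.comp G₁ (.reset (PureCtx.toEval E₁)) ∧ RelatedStack k' false G₀ G₁ ∧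
      RelatedCont E₀ E₁ := by
  generalize hb : true = b at h
  induction h with
  | nil =>
    refine .inl ⟨.hole, .hole, rfl, rfl, fun k' _ => ?_⟩
    exact .base (E₀ := .appR (.var k') .hole) (E₁ := .appR (.var k') .hole) (.refl _) .var
  | pure _ h hσ ih =>
    rcases ih hb with ⟨K₀, K₁, rfl, rfl, hK⟩ | ⟨k', G₀, G₁, K₀, K₁, rfl, rfl, hG, hK⟩
    · simp only [← PureCtx.toEval_comp]
      refine .inl ⟨_, _, rfl, rfl, fun k' ρ => ?_⟩
      simp only [PureCtx.rename_comp, PureCtx.rename_subst]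
      exact .push (hK k' ρ) h (hσ.rename ρ)
    · simp only [EvalCtx.comp_assoc, EvalCtx.comp, ← PureCtx.toEval_comp]
      exact .inr ⟨k', _, _, _, _, rfl, rfl, hG, .push hK h hσ⟩
  | eval => cases hb
  | delimited hF h hσ => exact .inr ⟨_, _, _, _, _, rfl, rfl, hF, .base h hσ⟩

end RelatedStack

namespace RelatedConfUpTo

variable {k : ℕ} {p q r s : Tm}

theorem of_relatedConf (h : RelatedConf k p q) : RelatedConfUpTo p q :=
  ⟨k, _, _, .refl _, h, .refl _⟩

theorem renClosed : RenClosed RelatedConfUpTo := by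
  rintro p q ρ ⟨k, a, b, hp, h, hq⟩
  refine ⟨k, _, _, RefinedBisimilar.renClosed _ _ ρ hp, ?_, RefinedBisimilar.renClosed _ _ ρ hq⟩
  cases h with
  | intro hF ht hs hσ =>
    simp only [EvalCtx.rename_plug, Tm.rename_subst]
    exact .intro (hF.rename ρ) ht hs (hσ.rename ρ)

theorem symm (h : RelatedConfUpTo p q) : RelatedConfUpTo q p := by
  obtain ⟨k, _, _, hp, ⟨hF, ht, hs, hσ⟩, hq⟩ := h
  exact ⟨k, _, _, hq.symm, .intro hF.symm ht.symm (fun hb => (hs hb).symm) hσ.symm, hp.symm⟩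

theorem freshNF_trans (h₁ : FreshNF RefinedBisimilar p q) (h₂ : FreshNF RelatedConfUpTo q r)
    (h₃ : FreshNF RefinedBisimilar r s) : FreshNF RelatedConfUpTo p s := by
  refine ((h₁.trans h₂).trans h₃).mono ?_
  rintro a d ⟨c, ⟨b, hab, k, b', c', hbb', hbc, hc'c⟩, hcd⟩
  exact ⟨k, b', c', hab.trans hbb', hbc, hc'c.trans hcd⟩

end RelatedConfUpTo

theorem RelatedStack.freshCtxRel {k : ℕ} {F₀ F₁ : EvalCtx} (h : RelatedStack k true F₀ F₁) :
    FreshCtxRel RelatedConfUpTo F₀ F₁ := by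
  rcases h.pure_or_delimited with ⟨E₀, E₁, rfl, rfl, -⟩ | ⟨k', G₀, G₁, E₀, E₁, rfl, rfl, hG, hE⟩
  · have hC := (h.rename Nat.succ).plug_toTm (.var 0)
    simp only [← PureCtx.toEval_rename, PureCtx.plug_toEval] at hC
    exact .pure (.of_relatedConf hC)
  · obtain ⟨k', hk⟩ := RelatedStack.nil.to_false.exists_delimited (hE.rename Nat.succ)
    have hC := hk.plug_toTm (.var 0)
    simp only [EvalCtx.comp, EvalCtx.plug, PureCtx.plug_toEval] at hC
    exact .delimited (.of_relatedConf ((hG.rename Nat.succ).plug_toTm (.var 0)))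
      (.of_relatedConf hC)

theorem refinedBisimilar_body_app (v : Val) :
    RefinedBisimilar v.body (.app (v.rename Nat.succ).toTm (.var 0)) := by
  cases v with
  | var n => exact .refl _
  | lam t =>
    refine (Adm.expand (.beta .hole _ (.var 0)) ?_).refinedBisimilar
    have hid : unbindRen 0 ∘ upRen Nat.succ = id := by funext n; cases n <;> rfl
    rw [EvalCtx.plug, Tm.inst_var, Tm.rename_rename, hid, Tm.rename_id]
    exact .refl _

theorem RelatedVal.body {v₀ v₁ : Val} (h : RelatedVal v₀ v₁) :
    RelatedConfUpTo v₀.body v₁.body :=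
  ⟨0, _, _, refinedBisimilar_body_app v₀,
    .intro (t₀ := .app (.var 0) (.var 1)) .nil (.refl _) (by simp)
      (.scons (h.rename Nat.succ) .var), (refinedBisimilar_body_app v₁).symm⟩

/-! ### Capturing composed contexts -/

theorem Adm.plug {t s : Tm} (h : Adm t s) (F : EvalCtx) : Adm (F.plug t) (F.plug s) := by
  induction F with
  | hole => exact h
  | appR v F ih => exact .app (.refl _) ih
  | appL F t ih => exact .app ih (.refl _)
  | reset F ih => exact .reset ih

theorem adm_inst_reify_comp (J E : PureCtx) (b : Tm) :
    Adm (.reset (b.inst (J.comp E).reify)) (.reset (b.inst (PureCtx.appR J.reify E).reify)) := by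
  refine .reset ((Adm.refl b).inst (.lam ?_))
  change Adm (.reset (J.comp E).body) _
  rw [PureCtx.body_comp]
  refine Adm.delay_of_body (e := J.body.rename (upRen Nat.succ)) ?_ (.refl _)
  rw [PureCtx.body_rename]
  exact .refl _

theorem refinedBisimilar_controlBody_comp (J E : PureCtx) (b : Tm) (σ : ℕ → Val) :
    RefinedBisimilar (controlBody (J.comp (E.subst σ)) (b.subst (upSub σ)))
      ((controlBody E b).subst (scons (PureCtx.appR (.var 0) (J.rename Nat.succ)).reify
        fun n => (σ n).rename Nat.succ)) := by
  have h := adm_inst_reify_comp (.appR (.var 0) (J.rename Nat.succ))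
    ((E.subst σ).rename Nat.succ) ((b.subst (upSub σ)).rename (upRen Nat.succ))
  rw [controlBody_subst_scons, ← PureCtx.rename_subst, ← rename_upRen_upSub, ← Tm.rename_subst,
    controlBody, PureCtx.rename_comp]
  exact h.refinedBisimilar

theorem RelatedConfUpTo.controlBody_comp {J₀ J₁ E₀ E₁ : PureCtx} {b₀ b₁ : Tm} {σ₀ σ₁ : ℕ → Val}
    (hJ : RelatedCont (.appR (.var 0) (J₀.rename Nat.succ)) (.appR (.var 0) (J₁.rename Nat.succ)))
    (h : RefinedBisimilar (controlBody E₀ b₀) (controlBody E₁ b₁)) (hσ : RelatedEnv σ₀ σ₁) :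
    RelatedConfUpTo (controlBody (J₀.comp (E₀.subst σ₀)) (b₀.subst (upSub σ₀)))
      (controlBody (J₁.comp (E₁.subst σ₁)) (b₁.subst (upSub σ₁))) :=
  ⟨0, _, _, refinedBisimilar_controlBody_comp _ _ _ _,
    .intro .nil h (by simp) (.scons (.reify hJ) (hσ.rename _)),
    (refinedBisimilar_controlBody_comp _ _ _ _).symm⟩

theorem RelatedStack.capture {k : ℕ} {G₀ G₁ : EvalCtx} {J₀ J₁ E₀ E₁ : PureCtx} {b₀ b₁ : Tm}
    {σ₀ σ₁ : ℕ → Val} (hG : RelatedStack k false G₀ G₁) (hJ : RelatedCont J₀ J₁)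
    (h : RefinedBisimilar (controlBody E₀ b₀) (controlBody E₁ b₁)) (hσ : RelatedEnv σ₀ σ₁) :
    RelatedConf k
      (G₀.plug (.reset ((b₀.subst (upSub σ₀)).inst (PureCtx.appR J₀.reify (E₀.subst σ₀)).reify)))
      (G₁.plug
        (.reset ((b₁.subst (upSub σ₁)).inst (PureCtx.appR J₁.reify (E₁.subst σ₁)).reify))) := by
  rw [← controlBody_subst_scons, ← controlBody_subst_scons]
  exact .intro hG h (fun _ => ⟨.reset _, .reset _⟩) (.scons (.reify hJ) hσ)

/-! ### Evaluation of related configurations -/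

theorem FreshNF.openStuck_left {R : Tm → Tm → Prop} {F : EvalCtx} {x : ℕ} {v : Val} {q : Tm}
    (h : FreshNF R (F.plug (.app (.var x) v.toTm)) q) :
    ∃ F' v', q = EvalCtx.plug F' (.app (.var x) (Val.toTm v')) ∧ FreshCtxRel R F F' ∧
      R v.body v'.body := by
  generalize hp : F.plug (.app (.var x) v.toTm) = p at h
  cases h with
  | openStuck hF hv =>
    obtain ⟨rfl, rfl, rfl⟩ : _ ∧ _ ∧ _ := by simpa using congrArg decomp hp
    exact ⟨_, _, rfl, hF, hv⟩
  | _ => simpa using congrArg decomp hp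

theorem FreshCtxRel.pure_left {R : Tm → Tm → Prop} {E : PureCtx} {F : EvalCtx}
    (h : FreshCtxRel R E.toEval F) : ∃ E', F = PureCtx.toEval E' ∧ R E.body E'.body := by
  generalize hG : E.toEval = G at h
  cases h with
  | pure hE =>
    obtain rfl : _ = _ := by simpa using congrArg EvalCtx.split hG
    exact ⟨_, rfl, hE⟩
  | delimited => simpa using congrArg EvalCtx.split hG

theorem exists_steps_app_toTm (v : Val) (σ : ℕ → Val) (u : Val) :
    ∃ s n, Steps s n (.app (v.subst σ).toTm u.toTm) (v.body.subst (scons u σ)) := by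
  cases v with
  | var n => exact ⟨0, 0, .refl _⟩
  | lam t =>
    have hbeta := Steps.single (Step.beta .hole (t.subst (upSub σ)) u)
    simp only [EvalCtx.plug, Tm.inst_subst_upSub] at hbeta
    exact ⟨_, _, hbeta⟩

/-- A value that is bisimilar to the variable `m` may be an abstraction, whose body calls `m` on a
related argument in a related stack. -/
theorem RelatedStack.exists_steps_app_of_var {k m : ℕ} {F₀ F₁ : EvalCtx} {u₀ u₁ v₁ : Val}
    {σ₀ σ₁ : ℕ → Val} (hF : RelatedStack k true F₀ F₁) (hu : RelatedVal u₀ u₁)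
    (hv : RefinedBisimilar (Val.var m).body v₁.body) (hσ : RelatedEnv σ₀ σ₁) :
    ∃ k' F₁' u₁' s n, RelatedStack k' true F₀ F₁' ∧ RelatedVal u₀ u₁' ∧
      Steps s n (F₁.plug (.app (v₁.subst σ₁).toTm u₁.toTm))
        (EvalCtx.plug F₁' (.app (σ₁ m).toTm (Val.toTm u₁'))) := by
  obtain ⟨q, hq, hn⟩ := hv.eval (isNormal_plug_app_var .hole (m + 1) (.var 0)).eval
  obtain ⟨F, v, rfl, hF', hv'⟩ := hn.openStuck_left
  obtain ⟨E, rfl, hE⟩ := FreshCtxRel.pure_left (E := .hole) hF'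
  obtain ⟨⟨s', n', hbody⟩, -⟩ := eval_iff.1 hq
  obtain ⟨s, n, happ⟩ := exists_steps_app_toTm v₁ σ₁ u₁
  have hσu := RelatedEnv.scons hu hσ
  have hstack := hF.pure hE hσu
  simp only [PureCtx.subst, PureCtx.toEval, EvalCtx.comp_hole] at hstack
  have hsteps := (happ.plug F₁).trans ((hbody.subst (scons u₁ σ₁)).plug F₁)
  simp only [PureCtx.plug_toEval, PureCtx.subst_plug, Tm.subst, ← Val.toTm_subst,
    scons_succ] at hsteps
  rw [← PureCtx.plug_toEval, ← EvalCtx.plug_comp] at hsteps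
  exact ⟨_, _, _, _, _, hstack, .closure (v₀ := .var 0) hv' hσu, hsteps⟩

/-- The term `q` evaluates to a normal form related to `p`. -/
def EvaluatesTo (p q : Tm) : Prop := ∃ q', Eval q q' ∧ FreshNF RelatedConfUpTo p q'

theorem EvaluatesTo.of_steps {s n : ℕ} {p q q' : Tm} (h : EvaluatesTo p q')
    (hs : Steps s n q q') : EvaluatesTo p q := by
  obtain ⟨r, hr, hN⟩ := h
  exact ⟨r, hs.eval hr, hN⟩

/-- The simulation property for the related configurations that capture fewer than `s` contexts,
or capture `s` contexts and need fewer than `n` steps, or need exactly `n` steps of which `s` are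
captures and have fewer than `k` frames. -/
def SimulatesBelow (s n k : ℕ) : Prop :=
  ∀ ⦃s' n' k' : ℕ⦄ ⦃p q p' : Tm⦄, s' < s ∨ s' = s ∧ (n' < n ∨ n' = n ∧ k' < k) →
    RelatedConf k' p q → Steps s' n' p p' → p'.IsNormal → EvaluatesTo p' q

namespace SimulatesBelow

variable {s n s' n' k k' : ℕ} {b : Bool} {F₀ F₁ : EvalCtx} {E₀ E₁ : PureCtx} {b₀ b₁ p' q t : Tm}
  {u₀ u₁ : Val} {σ₀ σ₁ : ℕ → Val}

theorem mono (hI : SimulatesBelow s n k) (hs : s' ≤ s) (hn : n' ≤ n) :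
    SimulatesBelow s' n' k := fun _ _ _ _ _ _ hlt => hI (by omega)

theorem of_step {p : Tm} (hI : SimulatesBelow s n k) (h : Step 0 p t) (hC : RelatedConf k' t q)
    (hs : Steps s n p p') (hn : p'.IsNormal) : EvaluatesTo p' q := by
  obtain ⟨s', n', hs', rfl, rfl⟩ := (Steps.single h).cancel hs hn
  exact hI (by omega) hC hs' hn

theorem value (hI : SimulatesBelow s n k) (hF : RelatedStack k b F₀ F₁) (hu : RelatedVal u₀ u₁)
    (hs : Steps s n (F₀.plug u₀.toTm) p') (hn : p'.IsNormal) :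
    EvaluatesTo p' (F₁.plug u₁.toTm) := by
  rcases hF.eq_hole_or_pop hu with ⟨rfl, rfl⟩ | ⟨k', hk, hC⟩
  · obtain rfl := hs.eq_of_isNormal (isNormal_toTm _)
    exact ⟨_, (isNormal_toTm _).eval, .value hu.body⟩
  · exact hI (by omega) hC hs hn

theorem capture {J₀ J₁ : PureCtx} (hI : SimulatesBelow s n k)
    (hF : RelatedStack k' false F₀ F₁) (hJ : RelatedCont J₀ J₁)
    (hb : RefinedBisimilar (controlBody E₀ b₀) (controlBody E₁ b₁)) (hσ : RelatedEnv σ₀ σ₁)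
    (hs : Steps s n
      (F₀.plug (.reset ((J₀.comp (E₀.subst σ₀)).plug (.shift (b₀.subst (upSub σ₀)))))) p')
    (hn : p'.IsNormal) :
    EvaluatesTo p'
      (F₁.plug (.reset ((J₁.comp (E₁.subst σ₁)).plug (.shift (b₁.subst (upSub σ₁)))))) := by
  obtain ⟨s', n', hs', hlt, -⟩ := (Steps.single (Step.capture F₀ _ _)).cancel hs hn
  have hadm₀ := (adm_inst_reify_comp J₀ (E₀.subst σ₀) (b₀.subst (upSub σ₀))).plug F₀
  have hadm₁ := (adm_inst_reify_comp J₁ (E₁.subst σ₁) (b₁.subst (upSub σ₁))).plug F₁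
  obtain ⟨p'', n'', hs'', hn'', hN₀⟩ := hadm₀.steps_isNormal hs' hn
  obtain ⟨q₁, hq₁, hN₁⟩ := hI (by omega) (hF.capture hJ hb hσ) hs'' hn''
  obtain ⟨q₂, hq₂, hN₂⟩ := hadm₁.refinedBisimilar.symm.eval hq₁
  exact ⟨q₂, (Steps.single (.capture F₁ _ _)).eval hq₂,
    RelatedConfUpTo.freshNF_trans (hN₀.mono fun _ _ h => h.refinedBisimilar) hN₁ hN₂⟩

theorem shift (hI : SimulatesBelow s n k) (hF : RelatedStack k true F₀ F₁)
    (hb : RefinedBisimilar (controlBody E₀ b₀) (controlBody E₁ b₁)) (hσ : RelatedEnv σ₀ σ₁)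
    (hs : Steps s n (F₀.plug ((E₀.plug (.shift b₀)).subst σ₀)) p') (hn : p'.IsNormal) :
    EvaluatesTo p' (F₁.plug ((E₁.plug (.shift b₁)).subst σ₁)) := by
  simp only [PureCtx.subst_plug, Tm.subst] at hs ⊢
  rcases hF.pure_or_delimited with ⟨J₀, J₁, rfl, rfl, hJ⟩ |
    ⟨k', G₀, G₁, J₀, J₁, rfl, rfl, hG, hJ⟩
  · simp only [PureCtx.plug_toEval, ← PureCtx.plug_comp] at hs ⊢
    obtain rfl := hs.eq_of_isNormal (isNormal_plug_shift _ _)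
    exact ⟨_, (isNormal_plug_shift _ _).eval, .controlStuck (.controlBody_comp (hJ _ _) hb hσ)⟩
  · simp only [EvalCtx.plug_comp, EvalCtx.plug, PureCtx.plug_toEval] at hs ⊢
    rw [← PureCtx.plug_comp] at hs ⊢
    exact hI.capture hG hJ hb hσ hs hn

theorem app (hI : SimulatesBelow s n k) {w₀ w₁ : Val} : RelatedVal w₀ w₁ →
    ∀ {k' : ℕ} {F₁ : EvalCtx} {u₁ : Val}, RelatedStack k' true F₀ F₁ → RelatedVal u₀ u₁ →
      Steps s n (F₀.plug (.app w₀.toTm u₀.toTm)) p' → p'.IsNormal →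
      EvaluatesTo p' (F₁.plug (.app w₁.toTm u₁.toTm))
  | .var x, _, _, _, hF, hu, hs, _ => by
    obtain rfl := hs.eq_of_isNormal (isNormal_plug_app_var _ x _)
    exact ⟨_, (isNormal_plug_app_var _ _ _).eval, .openStuck hF.freshCtxRel hu.body⟩
  | .closure (v₀ := .var _) hv hσ, _, _, _, hF, hu, hs, hn => by
    obtain ⟨k', F₁', u₁', s', n', hF', hu', hs'⟩ := hF.exists_steps_app_of_var hu hv hσ
    exact (app hI (hσ _) hF' hu' hs hn).of_steps hs'
  | .closure (v₀ := .lam t) (v₁ := v₁) (σ₁ := σ₁) hv hσ, _, F₁, u₁, hF, hu, hs, hn => by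
    obtain ⟨s', n', hs'⟩ := exists_steps_app_toTm v₁ σ₁ u₁
    have hC := RelatedConf.intro hF hv (by simp) (.scons hu hσ)
    rw [Val.body, ← Tm.inst_subst_upSub] at hC
    exact (hI.of_step (.beta _ _ _) hC hs hn).of_steps (hs'.plug F₁)
  | .reify (E₁ := E₁) hE, _, F₁, u₁, hF, hu, hs, hn => by
    obtain ⟨k', hF'⟩ := hF.to_false.exists_delimited hE
    have hC := hF'.plug_toTm hu
    simp only [EvalCtx.plug_comp, EvalCtx.plug, PureCtx.plug_toEval, ← PureCtx.body_inst] at hC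
    exact (hI.of_step (.beta _ _ _) hC hs hn).of_steps (.single (.beta F₁ (.reset E₁.body) u₁))

end SimulatesBelow

theorem RelatedConf.evaluatesTo {s n k : ℕ} {p q p' : Tm} (h : RelatedConf k p q)
    (hs : Steps s n p p') (hn : p'.IsNormal) : EvaluatesTo p' q := by
  have hI : SimulatesBelow s n k := fun _ _ _ _ _ _ _ h hs hn => h.evaluatesTo hs hn
  cases h with
  | @intro b F₀ F₁ t₀ t₁ σ₀ σ₁ hF ht hsafe hσ =>
    obtain ⟨s₁, n₁, s₂, n₂, t₀', hs₀, hn₀, hs', rfl, rfl⟩ :=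
      Steps.reflect (f := fun t => F₀.plug (t.subst σ₀)) (fun h => (h.subst σ₀).plug F₀) hs hn
    obtain ⟨t₁', he, hN⟩ := ht.eval (eval_iff.2 ⟨⟨_, _, hs₀⟩, hn₀⟩)
    obtain ⟨⟨s₃, n₃, hs₁⟩, -⟩ := eval_iff.1 he
    have hsafe' : b = false → Safe t₀' ∧ Safe t₁' :=
      fun hb => ⟨(hsafe hb).1.steps hs₀, (hsafe hb).2.steps hs₁⟩
    replace hI := hI.mono (s' := s₂) (n' := n₂) (by omega) (by omega)
    suffices EvaluatesTo p' (F₁.plug (t₁'.subst σ₁)) from this.of_steps ((hs₁.subst σ₁).plug F₁)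
    cases hN with
    | value hv =>
      simp only [← Val.toTm_subst] at hs' ⊢
      exact hI.value hF (.closure hv hσ) hs' hn
    | controlStuck hb =>
      cases b with
      | false => exact absurd (hsafe' rfl).1 (Safe.not_plug_shift _ _)
      | true => exact hI.shift hF hb hσ hs' hn
    | @openStuck _ _ x _ _ hG hv =>
      obtain ⟨k', hF'⟩ := hF.exists_push hG hsafe' hσ
      simp only [EvalCtx.subst_plug, Tm.subst, ← Val.toTm_subst, ← EvalCtx.plug_comp] at hs' ⊢
      exact hI.app (hσ x) hF' (.closure hv hσ) hs' hn
termination_by (s, n, k)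
decreasing_by simp only [Prod.lex_def]; assumption

theorem RelatedConfUpTo.refinedBisimilar {p q : Tm} (h : RelatedConfUpTo p q) :
    RefinedBisimilar p q := by
  refine .of_symmetric renClosed (fun _ _ h => h.symm) ?_ h
  rintro p q p' ⟨k, a, b, hpa, hab, hbq⟩ he
  obtain ⟨a', ha, hN₁⟩ := hpa.eval he
  obtain ⟨⟨s, n, hs⟩, hn⟩ := eval_iff.1 ha
  obtain ⟨b', hb, hN₂⟩ := hab.evaluatesTo hs hn
  obtain ⟨q', hq, hN₃⟩ := hbq.eval hb
  exact ⟨q', hq, freshNF_trans hN₁ hN₂ hN₃⟩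

/-! ### Congruence and soundness -/

theorem FreshNF.isValue {R : Tm → Tm → Prop} {p q : Tm} (h : FreshNF R p q) (hp : p.IsValue) :
    q.IsValue := by
  obtain ⟨v, rfl⟩ := hp
  generalize hv : v.toTm = p at h
  cases h with
  | @value _ v₁ _ => exact ⟨v₁, rfl⟩
  | _ => simpa using congrArg decomp hv

theorem FreshNF.controlStuck_right {R : Tm → Tm → Prop} {p q : Tm} (h : FreshNF R p q)
    (hp : p.ControlStuck) : q.ControlStuck := by
  obtain ⟨E, b, rfl⟩ := hp
  generalize hb : E.plug (.shift b) = p at h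
  cases h with
  | @controlStuck _ E₁ _ b₁ _ => exact ⟨E₁, b₁, rfl⟩
  | _ => simpa using congrArg decomp hb

namespace RefinedBisimilar

theorem subst {t₀ t₁ : Tm} (h : RefinedBisimilar t₀ t₁) {σ₀ σ₁ : ℕ → Val}
    (hσ : ∀ n, RefinedBisimilar (σ₀ n).body (σ₁ n).body) :
    RefinedBisimilar (t₀.subst σ₀) (t₁.subst σ₁) := by
  have hR : RelatedEnv σ₀ σ₁ := fun n => by
    simpa only [Val.subst_var] using RelatedVal.closure (hσ n) RelatedEnv.var
  exact (RelatedConfUpTo.of_relatedConf (.intro .nil h (by simp) hR)).refinedBisimilar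

theorem plug_of_relatedStack {k : ℕ} {F₀ F₁ : EvalCtx} {t₀ t₁ : Tm}
    (hF : RelatedStack k true F₀ F₁) (h : RefinedBisimilar t₀ t₁) :
    RefinedBisimilar (F₀.plug t₀) (F₁.plug t₁) := by
  have hC := RelatedConf.intro hF h (by simp) .var
  simp only [Tm.subst_var] at hC
  exact (RelatedConfUpTo.of_relatedConf hC).refinedBisimilar

theorem plug_pure {E₀ E₁ : PureCtx} {t₀ t₁ : Tm} (hE : RefinedBisimilar E₀.body E₁.body)
    (h : RefinedBisimilar t₀ t₁) : RefinedBisimilar (E₀.plug t₀) (E₁.plug t₁) := by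
  simpa only [EvalCtx.comp, PureCtx.subst_var, PureCtx.plug_toEval] using
    plug_of_relatedStack (.pure .nil hE .var) h

theorem plug_delimited {F₀ F₁ : EvalCtx} {E₀ E₁ : PureCtx} {t₀ t₁ : Tm}
    (hF : RefinedBisimilar F₀.body F₁.body)
    (hE : RefinedBisimilar (.reset E₀.body) (.reset E₁.body))
    (h : RefinedBisimilar t₀ t₁) :
    RefinedBisimilar (F₀.plug (.reset (E₀.plug t₀))) (F₁.plug (.reset (E₁.plug t₁))) := by
  simpa only [EvalCtx.comp, PureCtx.subst_var, EvalCtx.subst_var, EvalCtx.plug_comp, EvalCtx.plug,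
    PureCtx.plug_toEval] using
    plug_of_relatedStack (.delimited (.eval .nil hF (by simp) .var) hE .var) h

theorem reset {t₀ t₁ : Tm} (h : RefinedBisimilar t₀ t₁) :
    RefinedBisimilar (.reset t₀) (.reset t₁) :=
  plug_delimited (F₀ := .hole) (F₁ := .hole) (E₀ := .hole) (E₁ := .hole) (.refl _) (.refl _) h

theorem app {t₀ t₁ s₀ s₁ : Tm} (ht : RefinedBisimilar t₀ t₁) (hs : RefinedBisimilar s₀ s₁) :
    RefinedBisimilar (.app t₀ s₀) (.app t₁ s₁) := by
  refine plug_pure (E₀ := .appL .hole s₀) (E₁ := .appL .hole s₁) ?_ ht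
  exact plug_pure (E₀ := .appR (.var 0) .hole) (E₁ := .appR (.var 0) .hole) (.refl _)
    (renClosed _ _ Nat.succ hs)

theorem lam {t₀ t₁ : Tm} (h : RefinedBisimilar t₀ t₁) : RefinedBisimilar (.lam t₀) (.lam t₁) :=
  .of_isNormal (isNormal_toTm (.lam t₀)) (isNormal_toTm (.lam t₁))
    (.value (v₀ := .lam t₀) (v₁ := .lam t₁) h)

theorem shift {t₀ t₁ : Tm} (h : RefinedBisimilar t₀ t₁) :
    RefinedBisimilar (.shift t₀) (.shift t₁) := by
  refine .of_isNormal (isNormal_plug_shift .hole t₀) (isNormal_plug_shift .hole t₁)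
    (.controlStuck (E₀ := .hole) (E₁ := .hole) (reset ?_))
  simp only [Tm.inst_eq_subst]
  exact (renClosed _ _ _ h).subst fun _ => .refl _

theorem plug {t₀ t₁ : Tm} (h : RefinedBisimilar t₀ t₁) (C : Ctx) :
    RefinedBisimilar (C.plug t₀) (C.plug t₁) := by
  induction C with
  | hole => exact h
  | lam x C ih => exact lam (renClosed _ _ _ ih)
  | appR t C ih => exact app (.refl _) ih
  | appL C t ih => exact app ih (.refl _)
  | shift k C ih => exact shift (renClosed _ _ _ ih)
  | reset C ih => exact reset ih

theorem body_of_appVar {v₀ v₁ : Val} {x : ℕ} (h₀ : ¬ v₀.toTm.Free x) (h₁ : ¬ v₁.toTm.Free x)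
    (h : RefinedBisimilar (v₀.appVar x) (v₁.appVar x)) : RefinedBisimilar v₀.body v₁.body := by
  rw [← Val.appVar_rename_bindRen h₀, ← Val.appVar_rename_bindRen h₁]
  exact renClosed _ _ _ h

theorem body_of_plug_var {E₀ E₁ : PureCtx} {x : ℕ} (h₀ : ¬ E₀.Free x) (h₁ : ¬ E₁.Free x)
    (h : RefinedBisimilar (E₀.plug (.var x)) (E₁.plug (.var x))) :
    RefinedBisimilar E₀.body E₁.body := by
  rw [← PureCtx.plug_var_rename_bindRen h₀, ← PureCtx.plug_var_rename_bindRen h₁]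
  exact renClosed _ _ _ h

theorem reset_body_of_plug_var {E₀ E₁ : PureCtx} {x : ℕ} (h₀ : ¬ E₀.Free x) (h₁ : ¬ E₁.Free x)
    (h : RefinedBisimilar (.reset (E₀.plug (.var x))) (.reset (E₁.plug (.var x)))) :
    RefinedBisimilar (.reset E₀.body) (.reset E₁.body) := by
  rw [← PureCtx.plug_var_rename_bindRen h₀, ← PureCtx.plug_var_rename_bindRen h₁]
  exact renClosed _ _ (bindRen x) h

theorem body_of_evalCtx_plug_var {F₀ F₁ : EvalCtx} {x : ℕ} (h₀ : ¬ F₀.Free x) (h₁ : ¬ F₁.Free x)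
    (h : RefinedBisimilar (F₀.plug (.var x)) (F₁.plug (.var x))) :
    RefinedBisimilar F₀.body F₁.body := by
  rw [← EvalCtx.plug_var_rename_bindRen h₀, ← EvalCtx.plug_var_rename_bindRen h₁]
  exact renClosed _ _ _ h

theorem obsLe {p q : Tm} (h : RefinedBisimilar p q) : ObsLe p q := by
  constructor
  · rintro ⟨p', he, hv⟩
    obtain ⟨q', hq, hn⟩ := h.eval he
    exact ⟨q', hq, hn.isValue hv⟩
  · rintro ⟨p', he, hc⟩
    obtain ⟨q', hq, hn⟩ := h.eval he
    exact ⟨q', hq, hn.controlStuck_right hc⟩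

theorem ctxEquiv {t₀ t₁ : Tm} (h : RefinedBisimilar t₀ t₁) : CtxEquiv t₀ t₁ :=
  fun C _ _ => ⟨(h.plug C).obsLe, (h.plug C).symm.obsLe⟩

end RefinedBisimilar

theorem isCongruence_refinedBisimilar : IsCongruence RefinedBisimilar :=
  ⟨⟨.refl, .symm, .trans⟩, fun C _ _ h => h.plug C⟩

theorem Closure.refinedBisimilar {R : Tm → Tm → Prop} (hR : IsRefinedBisimulation R) {t₀ t₁ : Tm}
    (h : Closure R t₀ t₁) : RefinedBisimilar t₀ t₁ := by
  induction h with
  | refl t => exact .refl t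
  | base t₀ t₁ h => exact ⟨R, hR, h⟩
  | subst t₀ t₁ x v₀ v₁ y _ h₀ h₁ _ iht ihv =>
    refine iht.subst fun n => ?_
    by_cases hn : n = x
    · simp only [hn, if_true]
      exact .body_of_appVar h₀ h₁ ihv
    · simp only [hn, if_false]
      exact .refl _
  | pureCtx t₀ t₁ E₀ E₁ x _ h₀ h₁ _ iht ihE => exact .plug_pure (.body_of_plug_var h₀ h₁ ihE) iht
  | delimitedCtx t₀ t₁ F₀ F₁ E₀ E₁ x _ h₀ h₁ h₂ h₃ _ _ iht ihF ihE =>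
    exact .plug_delimited (.body_of_evalCtx_plug_var h₀ h₁ ihF)
      (.reset_body_of_plug_var h₂ h₃ ihE) iht
  | lam x t₀ t₁ _ ih => exact ih.plug (.lam x .hole)
  | shift k t₀ t₁ _ ih => exact ih.plug (.shift k .hole)
  | bisim t₀ t₀' t₁' t₁ h₀ _ h₁ ih => exact h₀.trans (ih.trans h₁)

theorem closure_eq_refinedBisimilar {R : Tm → Tm → Prop} (hR : IsRefinedBisimulation R) :
    Closure R = RefinedBisimilar := by
  funext t₀ t₁
  exact propext ⟨Closure.refinedBisimilar hR, fun h => .bisim t₀ t₁ t₁ t₁ h (.refl t₁) (.refl t₁)⟩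

/-! ### A contextual equivalence that is not a bisimilarity -/

/-- The divergent term `Ω = (λx. x x) (λx. x x)`. -/
def loopTm : Tm :=
  .app (.lam (.app (.var 0) (.var 0))) (.lam (.app (.var 0) (.var 0)))

theorem loopTm_step : Step 0 loopTm loopTm :=
  .beta .hole (.app (.var 0) (.var 0)) (.lam (.app (.var 0) (.var 0)))

/-- Terms of the form `Ω` or `⟨t⟩ Ω`. In evaluation position of a closed term they prevent it from
having a normal form. -/
def Hopeless (d : Tm) : Prop := d = loopTm ∨ ∃ t, d = .app (.reset t) loopTm

theorem Hopeless.subst {d : Tm} (h : Hopeless d) (σ : ℕ → Val) : Hopeless (d.subst σ) := by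
  rcases h with rfl | ⟨t, rfl⟩
  · exact .inl rfl
  · exact .inr ⟨t.subst σ, rfl⟩

theorem Hopeless.ne_toTm {d : Tm} (h : Hopeless d) (v : Val) : d ≠ v.toTm := by
  rcases h with rfl | ⟨t, rfl⟩ <;> cases v <;> exact Tm.noConfusion

/-- Terms with a hopeless term in evaluation position. -/
def HopelessAt (p : Tm) : Prop := ∃ F d, p = EvalCtx.plug F d ∧ Hopeless d

/-- Terms invariant under substitution. Unlike closedness, this property is preserved by reduction
for the mere reason that reduction is deterministic and commutes with substitution. -/
def SubstInvariant (p : Tm) : Prop := ∀ σ, p.subst σ = p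

theorem Tm.Closed.substInvariant {p : Tm} (h : p.Closed) : SubstInvariant p := fun _ =>
  (Tm.subst_congr (τ := Val.var) fun x hx => absurd hx (h x)).trans (Tm.subst_var p)

namespace SubstInvariant

theorem step {c : ℕ} {p p' : Tm} (h : SubstInvariant p) (hs : Step c p p') :
    SubstInvariant p' := by
  intro σ
  have hσ := hs.subst σ
  rw [h σ] at hσ
  exact (hσ.det hs).2

theorem ne_plug_app_var {p : Tm} (h : SubstInvariant p) (F : EvalCtx) (x : ℕ) (v : Val) :
    p ≠ F.plug (.app (.var x) v.toTm) := by
  rintro rfl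
  let σ : ℕ → Val := fun _ => .lam (.var 0)
  have hred : Step 0 ((F.subst σ).plug (.app (σ x).toTm (v.subst σ).toTm)) _ :=
    .beta (F.subst σ) (.var 0) (v.subst σ)
  have hσ : (F.subst σ).plug (.app (σ x).toTm (v.subst σ).toTm) =
      F.plug (.app (.var x) v.toTm) := by
    simpa only [EvalCtx.subst_plug, Tm.subst, ← Val.toTm_subst] using h σ
  rw [hσ] at hred
  exact (isNormal_plug_app_var F x v).not_step hred

end SubstInvariant

namespace HopelessAt

variable {p p' : Tm}

theorem of_hopeless {d : Tm} (h : Hopeless d) : HopelessAt d := ⟨.hole, d, rfl, h⟩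

theorem plug (h : HopelessAt p) (F : EvalCtx) : HopelessAt (F.plug p) := by
  obtain ⟨G, d, rfl, hd⟩ := h
  exact ⟨F.comp G, d, (EvalCtx.plug_comp _ _ _).symm, hd⟩

theorem app_of_step_reset {t r : Tm} {c : ℕ} (h : Step c (.reset t) r) :
    HopelessAt (.app r loopTm) := by
  rcases h.reset_inv with ⟨r, -, rfl⟩ | ⟨E, b, -, -, rfl⟩ | ⟨v, rfl, -, rfl⟩
  · exact of_hopeless (.inr ⟨_, rfl⟩)
  · exact of_hopeless (.inr ⟨_, rfl⟩)
  · exact (of_hopeless (.inl rfl)).plug (.appR v .hole)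

theorem exists_step (h : HopelessAt p) (hi : SubstInvariant p) :
    ∃ c p', Step c p p' ∧ HopelessAt p' := by
  obtain ⟨F, d, rfl, rfl | ⟨t, rfl⟩⟩ := h
  · exact ⟨0, _, loopTm_step.plug F, F, _, rfl, .inl rfl⟩
  rcases Tm.isNormal_or_exists_step (.reset t) with hn | ⟨c, r, hr⟩
  · generalize hs : Tm.reset t = s at hn hi
    cases hn using Tm.IsNormal.induct with
    | value v => cases v <;> cases hs
    | controlStuck E b => cases E <;> cases hs
    | openStuck G x v =>
      refine absurd ?_ (hi.ne_plug_app_var (F.comp (.appL G loopTm)) x v)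
      rw [EvalCtx.plug_comp, EvalCtx.plug]
  · exact ⟨c, _, (hr.plug (.appL .hole loopTm)).plug F, (app_of_step_reset hr).plug F⟩

theorem not_isNormal_of_steps {s n : ℕ} (h : HopelessAt p) (hi : SubstInvariant p)
    (hs : Steps s n p p') : ¬ p'.IsNormal := by
  induction hs with
  | refl =>
    obtain ⟨c, p', hp, -⟩ := h.exists_step hi
    exact fun hn => hn.not_step hp
  | head hs _ ih =>
    obtain ⟨c, p', hp, hh⟩ := h.exists_step hi
    obtain ⟨-, rfl⟩ := hs.det hp
    exact ih hh (hi.step hp)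

end HopelessAt

theorem not_eval_loopTm {t : Tm} : ¬ Eval loopTm t := by
  intro h
  obtain ⟨⟨s, n, hs⟩, hn⟩ := eval_iff.1 h
  exact (HopelessAt.of_hopeless (.inl rfl)).not_isNormal_of_steps (fun _ => rfl) hs hn

/-- Equality of terms up to hopeless subterms. -/
inductive HopelessEq : Tm → Tm → Prop
  | var (n : ℕ) : HopelessEq (.var n) (.var n)
  | lam {t s : Tm} : HopelessEq t s → HopelessEq (.lam t) (.lam s)
  | app {t s t' s' : Tm} : HopelessEq t s → HopelessEq t' s' → HopelessEq (.app t t') (.app s s')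
  | shift {t s : Tm} : HopelessEq t s → HopelessEq (.shift t) (.shift s)
  | reset {t s : Tm} : HopelessEq t s → HopelessEq (.reset t) (.reset s)
  | hopeless {d d' : Tm} : Hopeless d → Hopeless d' → HopelessEq d d'

namespace HopelessEq

variable {t s p q p' : Tm}

theorem refl (t : Tm) : HopelessEq t t := by
  induction t with
  | var n => exact .var n
  | lam t ih => exact .lam ih
  | app t s iht ihs => exact .app iht ihs
  | shift t ih => exact .shift ih
  | reset t ih => exact .reset ih

theorem symm (h : HopelessEq t s) : HopelessEq s t := by
  induction h with
  | var n => exact .var n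
  | lam _ ih => exact .lam ih
  | app _ _ ih ih' => exact .app ih ih'
  | shift _ ih => exact .shift ih
  | reset _ ih => exact .reset ih
  | hopeless h h' => exact .hopeless h' h

theorem rename (h : HopelessEq t s) (ρ : ℕ → ℕ) : HopelessEq (t.rename ρ) (s.rename ρ) := by
  induction h generalizing ρ with
  | var n => exact .var _
  | lam _ ih => exact .lam (ih _)
  | app _ _ ih ih' => exact .app (ih ρ) (ih' ρ)
  | shift _ ih => exact .shift (ih _)
  | reset _ ih => exact .reset (ih ρ)
  | hopeless h h' =>
    rw [Tm.rename_eq_subst, Tm.rename_eq_subst]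
    exact .hopeless (h.subst _) (h'.subst _)

theorem upSub {σ τ : ℕ → Val} (h : ∀ n, HopelessEq (σ n).toTm (τ n).toTm) (n : ℕ) :
    HopelessEq (upSub σ n).toTm (upSub τ n).toTm := by
  cases n with
  | zero => exact .var 0
  | succ n =>
    simp only [upSub_succ, Val.toTm_rename]
    exact (h n).rename _

theorem subst (h : HopelessEq t s) {σ τ : ℕ → Val} (hσ : ∀ n, HopelessEq (σ n).toTm (τ n).toTm) :
    HopelessEq (t.subst σ) (s.subst τ) := by
  induction h generalizing σ τ with
  | var n => exact hσ n
  | lam _ ih => exact .lam (ih (upSub hσ))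
  | app _ _ ih ih' => exact .app (ih hσ) (ih' hσ)
  | shift _ ih => exact .shift (ih (upSub hσ))
  | reset _ ih => exact .reset (ih hσ)
  | hopeless h h' => exact .hopeless (h.subst _) (h'.subst _)

theorem inst {v w : Val} (h : HopelessEq t s) (hv : HopelessEq v.toTm w.toTm) :
    HopelessEq (t.inst v) (s.inst w) := by
  simp only [Tm.inst_eq_subst]
  refine h.subst fun n => ?_
  cases n with
  | zero => exact hv
  | succ n => exact .var _

theorem plug (h : HopelessEq t s) (C : Ctx) : HopelessEq (C.plug t) (C.plug s) := by
  induction C with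
  | hole => exact h
  | lam x C ih => exact .lam (ih.rename _)
  | appR t C ih => exact .app (refl _) ih
  | appL C t ih => exact .app ih (refl _)
  | shift k C ih => exact .shift (ih.rename _)
  | reset C ih => exact .reset ih

theorem lam_left (h : HopelessEq (.lam t) q) : ∃ t', q = .lam t' ∧ HopelessEq t t' := by
  cases h with
  | lam h => exact ⟨_, rfl, h⟩
  | hopeless h _ => exact absurd rfl (h.ne_toTm (.lam t))

theorem toTm_left {v : Val} (h : HopelessEq v.toTm q) : ∃ v', q = Val.toTm v' := by
  cases v with
  | var x =>
    cases h with
    | var => exact ⟨.var x, rfl⟩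
    | hopeless h _ => exact absurd rfl (h.ne_toTm (.var x))
  | lam t =>
    obtain ⟨t', rfl, -⟩ := lam_left h
    exact ⟨.lam t', rfl⟩

theorem plug_shift_left {E : PureCtx} {b : Tm} (h : HopelessEq (E.plug (.shift b)) q) :
    HopelessAt (E.plug (.shift b)) ∨ ∃ E' b', q = PureCtx.plug E' (.shift b') ∧
      HopelessEq E.body E'.body ∧ HopelessEq b b' := by
  induction E generalizing q with
  | hole =>
    cases h with
    | shift h => exact .inr ⟨.hole, _, rfl, refl _, h⟩
    | hopeless h _ => exact .inl (.of_hopeless h)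
  | appR v E ih =>
    cases h with
    | hopeless h _ => exact .inl (.of_hopeless h)
    | app h h' =>
      obtain ⟨v', rfl⟩ := toTm_left h
      rcases ih h' with hh | ⟨E', b', rfl, hE, hb⟩
      · exact .inl (hh.plug (.appR v .hole))
      · refine .inr ⟨.appR v' E', b', rfl, .app ?_ hE, hb⟩
        simp only [Val.toTm_rename]
        exact h.rename _
  | appL E t ih =>
    cases h with
    | hopeless h _ => exact .inl (.of_hopeless h)
    | @app _ _ _ s h h' =>
      rcases ih h with hh | ⟨E', b', rfl, hE, hb⟩
      · exact .inl (hh.plug (.appL .hole t))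
      · exact .inr ⟨.appL E' s, b', rfl, .app hE (h'.rename _), hb⟩

theorem step {c : ℕ} (h : HopelessEq p q) (hp : Step c p p') :
    HopelessAt p ∨ ∃ q', Step c q q' ∧ HopelessEq p' q' := by
  induction h generalizing p' c with
  | var n => exact absurd hp (isNormal_toTm (.var n)).not_step
  | @lam t => exact absurd hp (isNormal_toTm (.lam t)).not_step
  | @shift t => exact absurd hp (isNormal_plug_shift .hole t).not_step
  | @app t s t' s' h h' ih ih' =>
    rcases hp.app_inv with ⟨r, hr, rfl⟩ | ⟨v, r, rfl, hr, rfl⟩ | ⟨b, v, rfl, rfl, rfl, rfl⟩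
    · rcases ih hr with hh | ⟨q, hq, ha⟩
      · exact .inl (hh.plug (.appL .hole _))
      · exact .inr ⟨_, hq.plug (.appL .hole s'), .app ha h'⟩
    · obtain ⟨v', rfl⟩ := toTm_left h
      rcases ih' hr with hh | ⟨q, hq, ha⟩
      · exact .inl (hh.plug (.appR v .hole))
      · exact .inr ⟨_, hq.plug (.appR v' .hole), .app h ha⟩
    · obtain ⟨b', rfl, hb⟩ := lam_left h
      obtain ⟨v', rfl⟩ := toTm_left h'
      exact .inr ⟨_, .beta .hole b' v', hb.inst h'⟩
  | @reset t s h ih =>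
    rcases hp.reset_inv with ⟨r, hr, rfl⟩ | ⟨E, b, rfl, rfl, rfl⟩ | ⟨v, rfl, rfl, rfl⟩
    · rcases ih hr with hh | ⟨q, hq, ha⟩
      · exact .inl (hh.plug (.reset .hole))
      · exact .inr ⟨_, hq.plug (.reset .hole), .reset ha⟩
    · rcases plug_shift_left h with hh | ⟨E', b', rfl, hE, hb⟩
      · exact .inl (hh.plug (.reset .hole))
      · exact .inr ⟨_, .capture .hole E' b', .reset (hb.inst (.lam (.reset hE)))⟩
    · obtain ⟨v', rfl⟩ := toTm_left h
      exact .inr ⟨_, .reset .hole v', h⟩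
  | hopeless h _ => exact .inl (.of_hopeless h)

theorem steps {m n : ℕ} (h : HopelessEq p q) (hi : SubstInvariant p) (hp : Steps m n p p')
    (hn : p'.IsNormal) : ∃ q', Steps m n q q' ∧ HopelessEq p' q' ∧ ¬ HopelessAt p' := by
  induction hp generalizing q with
  | refl t => exact ⟨q, .refl _, h, fun hh => hh.not_isNormal_of_steps hi (.refl _) hn⟩
  | head hs hs' ih =>
    rcases h.step hs with hh | ⟨q₁, hq, h⟩
    · exact absurd hn (hh.not_isNormal_of_steps hi (.head hs hs'))
    · obtain ⟨q₂, hq', h⟩ := ih h (hi.step hs) hn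
      exact ⟨q₂, .head hq hq', h⟩

theorem obsLe (h : HopelessEq p q) (hp : p.Closed) : ObsLe p q := by
  constructor
  · rintro ⟨p', he, v, rfl⟩
    obtain ⟨⟨s, n, hs⟩, hn⟩ := eval_iff.1 he
    obtain ⟨q', hq, h, -⟩ := h.steps hp.substInvariant hs hn
    obtain ⟨v', rfl⟩ := toTm_left h
    exact ⟨_, eval_iff.2 ⟨⟨_, _, hq⟩, isNormal_toTm v'⟩, v', rfl⟩
  · rintro ⟨p', he, E, b, rfl⟩
    obtain ⟨⟨s, n, hs⟩, hn⟩ := eval_iff.1 he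
    obtain ⟨q', hq, h, hh⟩ := h.steps hp.substInvariant hs hn
    obtain ⟨E', b', rfl, -, -⟩ := (plug_shift_left h).resolve_left hh
    exact ⟨_, eval_iff.2 ⟨⟨_, _, hq⟩, isNormal_plug_shift E' b'⟩, E', b', rfl⟩

theorem ctxEquiv (h : HopelessEq t s) : CtxEquiv t s :=
  fun C h₀ h₁ => ⟨(h.plug C).obsLe h₀, (h.plug C).symm.obsLe h₁⟩

end HopelessEq

theorem exists_ctxEquiv_not_refinedBisimilar :
    ∃ t₀ t₁ : Tm, CtxEquiv t₀ t₁ ∧ ¬ RefinedBisimilar t₀ t₁ := by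
  refine ⟨.app (.reset (.app (.var 0) (.lam (.var 0)))) loopTm, loopTm,
    (HopelessEq.hopeless (.inr ⟨_, rfl⟩) (.inl rfl)).ctxEquiv, fun h => ?_⟩
  obtain ⟨q, hq, -⟩ :=
    h.eval (isNormal_plug_app_var (.appL (.reset .hole) loopTm) 0 (.lam (.var 0))).eval
  exact not_eval_loopTm hq

end ShiftReset

theorem mainTheorem3 :
    (∀ R : ShiftReset.Tm → ShiftReset.Tm → Prop,
      ShiftReset.IsRefinedBisimulation R →
        ShiftReset.IsRefinedBisimulation (ShiftReset.Closure R)) ∧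
    ShiftReset.IsCongruence ShiftReset.RefinedBisimilar ∧
    (∀ t₀ t₁ : ShiftReset.Tm,
      ShiftReset.RefinedBisimilar t₀ t₁ → ShiftReset.CtxEquiv t₀ t₁) ∧
    (∃ t₀ t₁ : ShiftReset.Tm,
      ShiftReset.CtxEquiv t₀ t₁ ∧ ¬ ShiftReset.RefinedBisimilar t₀ t₁) := by
  refine ⟨fun R hR => ?_, ShiftReset.isCongruence_refinedBisimilar, fun _ _ h => h.ctxEquiv,
    ShiftReset.exists_ctxEquiv_not_refinedBisimilar⟩
  rw [ShiftReset.closure_eq_refinedBisimilar hR]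
  exact ShiftReset.refinedBisimilar_isGreatest.1
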